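/- A \emph{GF(2)-grammar} $G$ over an alphabet $\Sigma$ is, syntactically, an ordinary context-free grammar (with a finite set of rules and initial symbol $S$) such that every string $w\in\Sigma^*$ has only finitely many parse trees with root $S$; the language described by $G$ is the set of all $w\in\Sigma^*$ for which the number of these parse trees is odd. A language is \emph{inherently ambiguous} if it is context-free and every context-free grammar generating it is ambiguous, that is, assigns at least two parse trees with root the initial symbol to some string. Let $a,b,c$ be three distinct letters of an alphabet $\Sigma$. Then the language $$\{a^n b^m c^\ell \mid n,m,\ell\ge 0,\ n=m \text{ or } m=\ell\}$$ is not described by any GF(2)-grammar over $\Sigma$, and it is inherently ambiguous. -/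

import Mathlib

/-- A parse tree of an ordinary (context-free) grammar `g` whose root is labelled by the given
symbol. A terminal symbol labels only leaves. A node labelled by a nonterminal comes with a rule
`r` of the grammar for that nonterminal, and has one ordered child for each symbol occurrence of
the right-hand side of `r` (no children if the right-hand side is empty). -/
inductive ContextFreeGrammar.ParseTree {T : Type*} (g : ContextFreeGrammar T) :
    Symbol T g.NT → Type _
  | leaf (t : T) : ContextFreeGrammar.ParseTree g (Symbol.terminal t)
  | node (r : ContextFreeRule T g.NT) (hr : r ∈ g.rules)
      (children : ∀ i : Fin r.output.length, ContextFreeGrammar.ParseTree g (r.output.get i)) :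
      ContextFreeGrammar.ParseTree g (Symbol.nonterminal r.input)

/-- The string read off the leaves of a parse tree from left to right. -/
def ContextFreeGrammar.ParseTree.yield {T : Type*} {g : ContextFreeGrammar T} :
    {X : Symbol T g.NT} → g.ParseTree X → List T
  | _, .leaf t => [t]
  | _, .node _ _ children => (List.ofFn fun i => (children i).yield).flatten

/-- The set of parse trees of the string `w` as the nonterminal `A`. -/
def ContextFreeGrammar.parseTrees {T : Type*} (g : ContextFreeGrammar T) (A : g.NT) (w : List T) :
    Set (g.ParseTree (Symbol.nonterminal A)) :=
  {t | t.yield = w}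

/-- A grammar is unambiguous if every string has at most one parse tree as the initial symbol. -/
def ContextFreeGrammar.IsUnambiguous {T : Type*} (g : ContextFreeGrammar T) : Prop :=
  ∀ w : List T, (g.parseTrees g.initial w).Subsingleton

/-- A language is inherently ambiguous if it is context-free and every context-free grammar
that generates it is ambiguous. -/
def Language.IsInherentlyAmbiguous {T : Type*} (L : Language T) : Prop :=
  L.IsContextFree ∧ ∀ g : ContextFreeGrammar T, g.language = L → ¬ g.IsUnambiguous

/-- A GF(2)-grammar: syntactically an ordinary grammar (a finite set of rules
`A → X₁ ⊙ ⋯ ⊙ X_ℓ`), subject to the well-formedness condition that every string has only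
finitely many parse trees in the corresponding ordinary grammar. -/
structure GF2Grammar (T : Type*) extends ContextFreeGrammar T where
  /-- Every string has finitely many parse trees (as the initial symbol). -/
  wellFormed : ∀ w : List T, (toContextFreeGrammar.parseTrees initial w).Finite

/-- The language described by a GF(2)-grammar: the strings with an odd number of parse trees
as the initial symbol. -/
def GF2Grammar.language {T : Type*} (G : GF2Grammar T) : Language T :=
  {w : List T | Odd (G.toContextFreeGrammar.parseTrees G.initial w).ncard}

/-- The language `{aⁿ bᵐ cˡ | n = m or m = l}`, with `n, m, l ≥ 0`. -/
def someEqualLanguage {T : Type*} (a b c : T) : Language T :=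
  {w : List T | ∃ n m l : ℕ, (n = m ∨ m = l) ∧
    w = List.replicate n a ++ List.replicate m b ++ List.replicate l c}

/-! Write `x₀, x₁, x₂` for the variables of the power series ring over the field with two elements.
Each letter gets an upper triangular 3 × 3 matrix, the transition matrix of an automaton for `a* b*
c*`, and each symbol gets the sum of the matrix products over the yields of all its parse trees. If
a GF(2)-grammar describes the language, then the entry (0, 2) for the initial symbol is the sum of
`x₀ⁿ x₁ᵐ x₂ˡ` over `m, l ≥ 1` with `n = m` or `m = l`. The grammar restricts what this entry can be.

The entries at (p, p) solve a commutative polynomial system. Its Jacobian determinant is nonzero,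
because there are only finitely many parse trees for the empty string, so these entries are
algebraic series in `x_p` alone (`isAlgebraic_of_det_ne_zero`, `symMatrix_apply_self_mem`). The
entries at (p, q) with `p < q` solve a linear system whose coefficients come from the diagonal
entries p and q. By Cramer's rule (`det_smul_mem`) the determinant, a combination of products of
algebraic series in `x_p` and in `x_q`, is the only new denominator, and it can be rationalised to a
polynomial in these two variables. Hence the entry (0, 2) lies in `pairFractions`: numerators are
generated by univariate algebraic series, denominators are products of polynomials in two variables
each (`symMatrix_zero_two_mem`).

The series for `n = m` alone and for `m = l` alone are rational of this kind, so by inclusion and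
exclusion the sum of `(x₀x₁x₂)ⁿ` over `n ≥ 1` would be in `pairFractions` too. It is not
(`diagSeries_notMem_pairFractions`): a numerator has finite rank when `x₀` is separated from `x₁,
x₂`, whereas a multiple of the geometric series by a polynomial that survives the substitution `x₀ =
1/(x₁x₂)` has infinite rank. No nonzero polynomial in two of the variables vanishes under this
substitution.

Inherent ambiguity follows, since an unambiguous grammar is a GF(2)-grammar for the same language.
-/

namespace ContextFreeGrammar

/-! ### Parse trees as rules with forests -/

variable {T : Type*} {g : ContextFreeGrammar T}

/-- A family of parse trees, one for each symbol of a sentential form. -/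
abbrev Forest (g : ContextFreeGrammar T) (α : List (Symbol T g.NT)) : Type _ :=
  ∀ i : Fin α.length, g.ParseTree (α.get i)

/-- The string read off the leaves of a forest. -/
def Forest.yield {α : List (Symbol T g.NT)} (f : g.Forest α) : List T :=
  (List.ofFn fun i => (f i).yield).flatten

/-- A forest over `X :: α` is a parse tree of `X` together with a forest over `α`. -/
def Forest.consEquiv (X : Symbol T g.NT) (α : List (Symbol T g.NT)) :
    g.ParseTree X × g.Forest α ≃ g.Forest (X :: α) :=
  Fin.consEquiv fun i : Fin (α.length + 1) => g.ParseTree ((X :: α).get i)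

lemma Forest.yield_consEquiv {X : Symbol T g.NT} {α : List (Symbol T g.NT)}
    (p : g.ParseTree X × g.Forest α) :
    (Forest.consEquiv X α p).yield = p.1.yield ++ p.2.yield := by
  simp only [Forest.yield]
  exact (congrArg List.flatten (List.ofFn_succ (n := α.length))).trans (List.flatten_cons ..)

instance : Unique (g.Forest []) := Pi.uniqueOfIsEmpty fun i : Fin 0 => g.ParseTree ([].get i)

@[simp]
lemma Forest.yield_nil (f : g.Forest []) : f.yield = [] := rfl

lemma ParseTree.yield_node (r : ContextFreeRule T g.NT) (hr : r ∈ g.rules)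
    (f : g.Forest r.output) : (ParseTree.node r hr f).yield = f.yield := by
  rfl

@[simp]
lemma ParseTree.yield_leaf (t : T) : (ParseTree.leaf t : g.ParseTree (.terminal t)).yield = [t] := by
  rw [ParseTree.yield]

/-- The parse trees of a nonterminal are given by a rule for it and a forest over its right-hand
side. -/
def ParseTree.sigmaEquiv (A : g.NT) :
    (Σ r : {r : ContextFreeRule T g.NT // r ∈ g.rules ∧ r.input = A}, g.Forest r.1.output) ≃
      g.ParseTree (.nonterminal A) where
  toFun x := x.1.2.2 ▸ ParseTree.node x.1.1 x.1.2.1 x.2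
  invFun
    | .node r hr f => ⟨⟨r, hr, rfl⟩, f⟩
  left_inv := by
    rintro ⟨⟨r, hr, rfl⟩, f⟩
    rfl
  right_inv t := by
    cases t
    rfl

lemma ParseTree.yield_sigmaEquiv (A : g.NT)
    (x : Σ r : {r : ContextFreeRule T g.NT // r ∈ g.rules ∧ r.input = A}, g.Forest r.1.output) :
    (ParseTree.sigmaEquiv A x).yield = x.2.yield := by
  obtain ⟨⟨r, hr, rfl⟩, f⟩ := x
  exact ParseTree.yield_node r hr f

instance (t : T) : Unique (g.ParseTree (.terminal t)) where
  default := .leaf t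
  uniq x := by cases x; rfl

/-! ### Sentential forms and the strings of their forests -/

/-- The string `w` is the yield of some forest over `α`. -/
def Yields (g : ContextFreeGrammar T) (α : List (Symbol T g.NT)) (w : List T) : Prop :=
  ∃ f : g.Forest α, f.yield = w

lemma yields_nil {w : List T} : g.Yields [] w ↔ w = [] :=
  ⟨fun ⟨f, hf⟩ => hf.symm.trans f.yield_nil, fun h => ⟨default, h.symm⟩⟩

lemma yields_cons {X : Symbol T g.NT} {α : List (Symbol T g.NT)} {w : List T} :
    g.Yields (X :: α) w ↔ ∃ (t : g.ParseTree X) (v : List T), g.Yields α v ∧ w = t.yield ++ v := by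
  constructor
  · rintro ⟨f, rfl⟩
    obtain ⟨p, rfl⟩ := (Forest.consEquiv X α).surjective f
    exact ⟨p.1, _, ⟨p.2, rfl⟩, Forest.yield_consEquiv p⟩
  · rintro ⟨t, _, ⟨f, rfl⟩, rfl⟩
    exact ⟨Forest.consEquiv X α (t, f), Forest.yield_consEquiv _⟩

lemma yields_append {α β : List (Symbol T g.NT)} {w : List T} :
    g.Yields (α ++ β) w ↔ ∃ u v, g.Yields α u ∧ g.Yields β v ∧ w = u ++ v := by
  induction α generalizing w with
  | nil => simp [yields_nil]
  | cons X α ih =>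
    simp only [List.cons_append, yields_cons, ih]
    constructor
    · rintro ⟨t, _, ⟨u, v, hu, hv, rfl⟩, rfl⟩
      exact ⟨_, v, ⟨t, u, hu, rfl⟩, hv, by simp⟩
    · rintro ⟨_, v, ⟨t, u, hu, rfl⟩, hv, rfl⟩
      exact ⟨t, _, ⟨u, v, hu, hv, rfl⟩, by simp⟩

lemma yields_singleton {X : Symbol T g.NT} {w : List T} :
    g.Yields [X] w ↔ ∃ t : g.ParseTree X, t.yield = w := by
  simp only [yields_cons, yields_nil]
  constructor
  · rintro ⟨t, _, rfl, rfl⟩; exact ⟨t, by simp⟩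
  · rintro ⟨t, rfl⟩; exact ⟨t, [], rfl, by simp⟩

lemma yields_map_terminal (w : List T) : g.Yields (w.map .terminal) w := by
  induction w with
  | nil => exact yields_nil.2 rfl
  | cons t w ih => exact yields_cons.2 ⟨.leaf t, w, ih, by simp⟩

lemma Produces.yields {α β : List (Symbol T g.NT)} {w : List T} (h : g.Produces α β)
    (hw : g.Yields β w) : g.Yields α w := by
  obtain ⟨r, hr, h⟩ := h
  obtain ⟨p, q, rfl, rfl⟩ := h.exists_parts
  obtain ⟨_, v, hu, hv, rfl⟩ := yields_append.1 hw
  obtain ⟨u, _, hu', ⟨f, rfl⟩, rfl⟩ := yields_append.1 hu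
  exact yields_append.2 ⟨_, v, yields_append.2 ⟨u, f.yield, hu',
    yields_singleton.2 ⟨.node r hr f, ParseTree.yield_node r hr f⟩, rfl⟩, hv, rfl⟩

lemma Derives.yields {α : List (Symbol T g.NT)} {w : List T}
    (h : g.Derives α (w.map .terminal)) : g.Yields α w := by
  induction h using Relation.ReflTransGen.head_induction_on with
  | refl => exact yields_map_terminal w
  | head h _ ih => exact h.yields ih

lemma Derives.append {α α' β β' : List (Symbol T g.NT)} (h : g.Derives α α')
    (h' : g.Derives β β') : g.Derives (α ++ β) (α' ++ β') :=
  (h.append_right β).trans (h'.append_left α')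

lemma derives_of_forest (α : List (Symbol T g.NT)) (f : g.Forest α)
    (h : ∀ i, g.Derives [α.get i] ((f i).yield.map .terminal)) :
    g.Derives α (f.yield.map .terminal) := by
  induction α with
  | nil => exact Derives.refl _
  | cons X α ih =>
    obtain ⟨p, rfl⟩ := (Forest.consEquiv X α).surjective f
    rw [Forest.yield_consEquiv, List.map_append]
    exact Derives.append (α := [X]) (h 0) (ih p.2 fun i => h i.succ)

lemma ParseTree.derives {X : Symbol T g.NT} (t : g.ParseTree X) :
    g.Derives [X] (t.yield.map .terminal) := by
  induction t with
  | leaf t => simpa using Derives.refl _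
  | node r hr f ih =>
    rw [ParseTree.yield_node]
    exact Produces.trans_derives ⟨r, hr, ContextFreeRule.Rewrites.input_output⟩
      (derives_of_forest _ f ih)

lemma mem_language_iff_exists_parseTree {w : List T} :
    w ∈ g.language ↔ ∃ t : g.ParseTree (.nonterminal g.initial), t.yield = w := by
  rw [mem_language_iff]
  exact ⟨fun h => yields_singleton.1 h.yields, fun ⟨t, ht⟩ => ht ▸ t.derives⟩

/-- An unambiguous grammar is a GF(2)-grammar for the same language. -/
lemma IsUnambiguous.exists_gf2Grammar (h : g.IsUnambiguous) :
    ∃ G : GF2Grammar T, G.language = g.language := by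
  refine ⟨⟨g, fun w => (h w).finite⟩, ?_⟩
  ext w
  rw [mem_language_iff_exists_parseTree]
  change Odd (g.parseTrees g.initial w).ncard ↔ (g.parseTrees g.initial w).Nonempty
  -- The number of parse trees is 0 or 1, so being odd and being positive agree.
  rcases (h w).eq_empty_or_singleton with h0 | ⟨t, ht⟩
  · simp [h0]
  · simp [ht]

/-! ### Symbols with finitely many parse trees for every string -/

/-- A symbol with at least one parse tree, and only finitely many for each string. -/
def IsGood (g : ContextFreeGrammar T) (X : Symbol T g.NT) : Prop :=
  Nonempty (g.ParseTree X) ∧ ∀ w : List T, {t : g.ParseTree X | t.yield = w}.Finite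

lemma isGood_terminal (t : T) : g.IsGood (.terminal t) :=
  ⟨⟨.leaf t⟩, fun _ => Set.toFinite _⟩

instance : Finite {A : g.NT // g.IsGood (.nonterminal A)} := by
  classical
  refine Set.Finite.subset (g.rules.image (·.input)).finite_toSet ?_
  rintro A ⟨⟨t⟩, -⟩
  cases t with
  | node r hr f => exact Finset.mem_coe.2 (Finset.mem_image_of_mem _ hr)

/-- With the other subtrees of `f` fixed, the trees of one child with a given yield inject into the
trees of the root with a given yield, of which there are finitely many. So a rule of a good
nonterminal that contains a bad symbol has no forest at all. -/
lemma IsGood.of_forest {r : ContextFreeRule T g.NT} (h : g.IsGood (.nonterminal r.input))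
    (hr : r ∈ g.rules) (f : g.Forest r.output) : ∀ X ∈ r.output, g.IsGood X := by
  classical
  intro X hX
  obtain ⟨i, rfl⟩ := List.get_of_mem hX
  refine ⟨⟨f i⟩, fun w => ?_⟩
  by_cases hw : ∃ t : g.ParseTree (r.output.get i), t.yield = w
  swap
  · simp only [not_exists] at hw
    simp [hw]
  obtain ⟨t₁, ht₁⟩ := hw
  let F : g.ParseTree (r.output.get i) → g.ParseTree (.nonterminal r.input) :=
    fun t => .node r hr (Function.update f i t)
  refine Set.Finite.of_injOn (f := F) (t := {t | t.yield = (F t₁).yield}) ?_ ?_ (h.2 _)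
  · intro t ht
    simp only [Set.mem_ofPred_eq] at ht ⊢
    simp only [F, ParseTree.yield_node]
    refine congrArg List.flatten (congrArg List.ofFn (funext fun j => ?_))
    by_cases hj : j = i
    · subst hj; simp [ht, ht₁]
    · simp [hj]
  · intro t _ t' _ htt
    have : (Function.update f i t : g.Forest r.output) = Function.update f i t' := by
      simpa only [F, ParseTree.node.injEq, heq_eq_eq, true_and] using htt
    exact Function.update_injective f i this

/-- The number of internal nodes of a parse tree. -/
def ParseTree.size : {X : Symbol T g.NT} → g.ParseTree X → ℕ
  | _, .leaf _ => 0
  | _, .node _ _ children => 1 + ∑ i, (children i).size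

/-- The number of internal nodes of a forest. -/
def Forest.size {α : List (Symbol T g.NT)} (f : g.Forest α) : ℕ := ∑ i, (f i).size

lemma ParseTree.size_node (r : ContextFreeRule T g.NT) (hr : r ∈ g.rules)
    (f : g.Forest r.output) : (ParseTree.node r hr f).size = 1 + f.size := by
  rfl

lemma Forest.size_consEquiv {X : Symbol T g.NT} {α : List (Symbol T g.NT)}
    (p : g.ParseTree X × g.Forest α) :
    (Forest.consEquiv X α p).size = p.1.size + p.2.size :=
  Fin.sum_univ_succ (n := α.length) fun i => ((Forest.consEquiv X α p) i).size

/-- Every parse tree of `B` can be grown to a bigger parse tree of `A` for the same string. -/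
def Grows (g : ContextFreeGrammar T) (B A : g.NT) : Prop :=
  ∀ t : g.ParseTree (.nonterminal B), ∃ t' : g.ParseTree (.nonterminal A),
    t'.yield = t.yield ∧ t.size < t'.size

lemma Grows.trans {A B C : g.NT} (h : g.Grows A B) (h' : g.Grows B C) : g.Grows A C := by
  intro t
  obtain ⟨t₁, h₁, h₁'⟩ := h t
  obtain ⟨t₂, h₂, h₂'⟩ := h' t₁
  exact ⟨t₂, h₂.trans h₁, h₁'.trans h₂'⟩

/-- Otherwise a largest tree for some string could be enlarged without changing the string. -/
lemma IsGood.not_grows {A : g.NT} (h : g.IsGood (.nonterminal A)) : ¬ g.Grows A A := by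
  intro hA
  obtain ⟨⟨t⟩, hfin⟩ := h
  obtain ⟨t₁, ht₁, hmax⟩ := Set.exists_max_image _ ParseTree.size (hfin t.yield) ⟨t, rfl⟩
  obtain ⟨t₂, ht₂, hlt⟩ := hA t₁
  exact absurd (hmax t₂ (ht₂.trans ht₁)) (not_le.2 hlt)

lemma wellFounded_grows :
    WellFounded fun A B : {A : g.NT // g.IsGood (.nonterminal A)} => g.Grows A.1 B.1 :=
  have : IsTrans {A : g.NT // g.IsGood (.nonterminal A)} fun A B => g.Grows A.1 B.1 :=
    ⟨fun _ _ _ => Grows.trans⟩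
  have : Std.Irrefl fun A B : {A : g.NT // g.IsGood (.nonterminal A)} => g.Grows A.1 B.1 :=
    ⟨fun A => A.2.not_grows⟩
  Finite.wellFounded_of_trans_of_irrefl _

/-- The rules for `A` with a right-hand side consisting of good symbols. -/
noncomputable def goodRules (g : ContextFreeGrammar T) (A : g.NT) :
    Finset (ContextFreeRule T g.NT) :=
  open Classical in g.rules.filter fun r => r.input = A ∧ ∀ X ∈ r.output, g.IsGood X

lemma mem_goodRules {A : g.NT} {r : ContextFreeRule T g.NT} :
    r ∈ g.goodRules A ↔ r ∈ g.rules ∧ r.input = A ∧ ∀ X ∈ r.output, g.IsGood X := by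
  simp [goodRules]

end ContextFreeGrammar

/-! ### Linear systems attached to a grammar -/

namespace ContextFreeGrammar

variable {T : Type*} {g : ContextFreeGrammar T}

/-- The nonterminals with at least one parse tree, and only finitely many for each string. -/
abbrev GoodNT (g : ContextFreeGrammar T) : Type := {A : g.NT // g.IsGood (.nonterminal A)}

noncomputable instance : Fintype g.GoodNT := Fintype.ofFinite _

noncomputable instance : DecidableEq g.GoodNT := Classical.decEq _

/-- The sum, over the occurrences of `B` in a sentential form, of the product of the values of `u`
before and the values of `v` after the occurrence. -/
noncomputable def pathCoeff {S : Type*} [CommSemiring S] (u v : Symbol T g.NT → S) (B : g.NT) :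
    List (Symbol T g.NT) → S
  | [] => 0
  | X :: α => u X * pathCoeff u v B α +
      open Classical in if X = .nonterminal B then (α.map v).prod else 0

/-- The matrix of the linear system for the good nonterminals with coefficients `pathCoeff`. -/
noncomputable def jacobian {S : Type*} [CommSemiring S] (u v : Symbol T g.NT → S) :
    Matrix g.GoodNT g.GoodNT S :=
  fun A B => ∑ r ∈ g.goodRules A.1, pathCoeff u v B.1 r.output

lemma map_pathCoeff {S S' : Type*} [CommSemiring S] [CommSemiring S'] (φ : S →+* S')
    (u v : Symbol T g.NT → S) (B : g.NT) (α : List (Symbol T g.NT)) :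
    φ (pathCoeff u v B α) = pathCoeff (fun X => φ (u X)) (fun X => φ (v X)) B α := by
  induction α with
  | nil => simp [pathCoeff]
  | cons X α ih =>
    simp only [pathCoeff, map_add, map_mul, ih]
    split_ifs <;> simp [map_list_prod, Function.comp_def]

lemma map_jacobian {S S' : Type*} [CommSemiring S] [CommSemiring S'] (φ : S →+* S')
    (u v : Symbol T g.NT → S) :
    (jacobian u v).map φ = jacobian (fun X => φ (u X)) (fun X => φ (v X)) := by
  ext A B
  simp [jacobian, map_pathCoeff]

lemma map_det_one_sub_jacobian {S S' : Type*} [CommRing S] [CommRing S'] (φ : S →+* S')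
    (u v : Symbol T g.NT → S) :
    φ (1 - jacobian u v).det = (1 - jacobian (fun X => φ (u X)) (fun X => φ (v X))).det := by
  rw [RingHom.map_det, map_sub, map_one, RingHom.mapMatrix_apply, map_jacobian]

lemma exists_forest_of_prod_ne_zero {S : Type*} [CommSemiring S] {e : Symbol T g.NT → S}
    (he : ∀ X, e X ≠ 0 → ∃ t : g.ParseTree X, t.yield = []) {α : List (Symbol T g.NT)}
    (h : (α.map e).prod ≠ 0) : ∃ f : g.Forest α, f.yield = [] := by
  induction α with
  | nil => exact ⟨default, rfl⟩
  | cons X α ih =>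
    rw [List.map_cons, List.prod_cons] at h
    obtain ⟨f, hf⟩ := ih (right_ne_zero_of_mul h)
    obtain ⟨t, ht⟩ := he X (left_ne_zero_of_mul h)
    exact ⟨Forest.consEquiv X α (t, f), by simp [Forest.yield_consEquiv, ht, hf]⟩

/-- A nonzero coefficient singles out an occurrence of `B` such that all other symbols have parse
trees of the empty string; `t` is grafted at this occurrence. -/
lemma exists_forest_of_pathCoeff_ne_zero {S : Type*} [CommSemiring S] {e : Symbol T g.NT → S}
    (he : ∀ X, e X ≠ 0 → ∃ t : g.ParseTree X, t.yield = []) {B : g.NT}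
    {α : List (Symbol T g.NT)} (h : pathCoeff e e B α ≠ 0) (t : g.ParseTree (.nonterminal B)) :
    ∃ f : g.Forest α, f.yield = t.yield ∧ t.size ≤ f.size := by
  induction α with
  | nil => exact absurd rfl h
  | cons X α ih =>
    by_cases h' : e X * pathCoeff e e B α = 0
    · rw [pathCoeff, h', zero_add] at h
      split_ifs at h with hX
      · subst hX
        obtain ⟨f, hf⟩ := exists_forest_of_prod_ne_zero he h
        exact ⟨Forest.consEquiv _ α (t, f), by simp [Forest.yield_consEquiv, hf],
          by simp [Forest.size_consEquiv]⟩
      · exact absurd rfl h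
    · obtain ⟨f, hf, hs⟩ := ih (right_ne_zero_of_mul h')
      obtain ⟨t', ht'⟩ := he X (left_ne_zero_of_mul h')
      exact ⟨Forest.consEquiv X α (t', f), by simp [Forest.yield_consEquiv, hf, ht'],
        by rw [Forest.size_consEquiv]; exact hs.trans (Nat.le_add_left _ _)⟩

lemma grows_of_jacobian_ne_zero {S : Type*} [CommSemiring S] {e : Symbol T g.NT → S}
    (he : ∀ X, e X ≠ 0 → ∃ t : g.ParseTree X, t.yield = []) {A B : g.GoodNT}
    (h : jacobian e e A B ≠ 0) : g.Grows B.1 A.1 := by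
  intro t
  obtain ⟨r, hr, hne⟩ := Finset.exists_ne_zero_of_sum_ne_zero h
  obtain ⟨hr', hA, -⟩ := mem_goodRules.1 hr
  obtain ⟨f, hf, hs⟩ := exists_forest_of_pathCoeff_ne_zero he hne t
  obtain ⟨A, hA'⟩ := A
  subst hA
  exact ⟨.node r hr' f, hf, by rw [ParseTree.size_node]; lia⟩

/-- The linear system is nonsingular if its coefficients count parse trees of the empty string. -/
lemma det_one_sub_jacobian_ne_zero {K : Type*} [Field K] {e : Symbol T g.NT → K}
    (he : ∀ X, e X ≠ 0 → ∃ t : g.ParseTree X, t.yield = []) : (1 - jacobian e e).det ≠ 0 := by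
  intro h
  obtain ⟨x, hx, h⟩ := Matrix.exists_mulVec_eq_zero_iff.2 h
  refine hx (funext fun A => ?_)
  induction A using (wellFounded_grows (g := g)).induction with
  | _ A ih =>
    have hA := congrFun h A
    -- A kernel vector satisfies `x = J x`, which expresses `x A` through those `x B` for which `B`
    -- grows to `A`. Well-founded induction then gives zero.
    rw [Matrix.sub_mulVec, Matrix.one_mulVec, Pi.sub_apply, Pi.zero_apply, sub_eq_zero] at hA
    rw [hA]
    refine Finset.sum_eq_zero fun B _ => ?_
    by_cases hB : jacobian e e A B = 0
    · exact mul_eq_zero_of_left hB _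
    · rw [ih B (grows_of_jacobian_ne_zero he hB), Pi.zero_apply, mul_zero]

section Solve

variable {S M : Type*} [CommRing S] [AddCommGroup M] [Module S M]

/-- Modulo `V`, `h` obeys a twisted Leibniz rule with weights `u` to the left and `v` to the right.
Unrolling it gives one term per symbol occurrence, and terminals contribute nothing. It is applied
both to derivations and to off-diagonal matrix entries. -/
lemma sub_sum_pathCoeff_smul_mem {u v : Symbol T g.NT → S} {V : AddSubgroup M}
    {h : List (Symbol T g.NT) → M} {d : Symbol T g.NT → M} (h_nil : h [] ∈ V)
    (h_cons : ∀ X α, h (X :: α) - (u X • h α + (α.map v).prod • d X) ∈ V)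
    (hu : ∀ X, ∀ m ∈ V, u X • m ∈ V) (hv : ∀ α t, (List.map v α).prod • d (.terminal t) ∈ V)
    {α : List (Symbol T g.NT)} (hα : ∀ X ∈ α, g.IsGood X) :
    h α - ∑ B : g.GoodNT, pathCoeff u v B.1 α • d (.nonterminal B.1) ∈ V := by
  classical
  induction α with
  | nil => simpa [pathCoeff] using h_nil
  | cons X α ih =>
    have key : (α.map v).prod • d X - ∑ B : g.GoodNT,
        (if X = .nonterminal B.1 then (α.map v).prod else 0) • d (.nonterminal B.1) ∈ V := by
      rcases X with t | A
      · simpa using hv α t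
      · rw [Finset.sum_eq_single ⟨A, hα _ (by simp)⟩]
        · simp
        · rintro B - hB
          rw [if_neg, zero_smul]
          rintro h
          exact hB (Subtype.ext (Symbol.nonterminal.inj h).symm)
        · simp
    convert V.add_mem (V.add_mem (h_cons X α) key)
      (hu X _ (ih fun Y hY => hα Y (List.mem_cons_of_mem _ hY))) using 1
    simp only [pathCoeff, add_smul, Finset.sum_add_distrib, mul_smul, smul_sub, Finset.smul_sum]
    abel

/-- Cramer's rule for the linear system of a grammar, modulo the subgroup `V`. -/
lemma det_smul_mem {u v : Symbol T g.NT → S} {V : AddSubgroup M} (W : Subring S)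
    (huW : ∀ X, u X ∈ W) (hvW : ∀ X, v X ∈ W) (hWV : ∀ s ∈ W, ∀ m ∈ V, s • m ∈ V)
    {h : List (Symbol T g.NT) → M} {d : Symbol T g.NT → M} (h_nil : h [] ∈ V)
    (h_cons : ∀ X α, h (X :: α) - (u X • h α + (α.map v).prod • d X) ∈ V)
    (hd : ∀ t, d (.terminal t) ∈ V)
    (h_sum : ∀ A, g.IsGood (.nonterminal A) →
      d (.nonterminal A) = ∑ r ∈ g.goodRules A, h r.output)
    {A : g.NT} (hA : g.IsGood (.nonterminal A)) :
    (1 - jacobian u v).det • d (.nonterminal A) ∈ V := by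
  have key (A : g.GoodNT) :
      ∑ B : g.GoodNT, (1 - jacobian u v) A B • d (.nonterminal B.1) ∈ V := by
    have : ∑ B : g.GoodNT, (1 - jacobian u v) A B • d (.nonterminal B.1) =
        ∑ r ∈ g.goodRules A.1, (h r.output -
          ∑ B : g.GoodNT, pathCoeff u v B.1 r.output • d (.nonterminal B.1)) := by
      simp only [Matrix.sub_apply, sub_smul, Finset.sum_sub_distrib, Matrix.one_apply, ite_smul,
        one_smul, zero_smul, Finset.sum_ite_eq, Finset.mem_univ, if_true, h_sum A.1 A.2, jacobian,
        Finset.sum_smul]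
      rw [Finset.sum_comm]
    rw [this]
    refine sum_mem fun r hr => sub_sum_pathCoeff_smul_mem h_nil h_cons
      (fun X => hWV _ (huW X)) (fun α t => hWV _ (list_prod_mem ?_) _ (hd t))
      (mem_goodRules.1 hr).2.2
    simpa using fun X _ => hvW X
  -- The subgroup `V` is stable only under `W`, so the adjugate is computed over `W` to see that its
  -- entries lie there.
  let u' : Symbol T g.NT → W := fun X => ⟨u X, huW X⟩
  let v' : Symbol T g.NT → W := fun X => ⟨v X, hvW X⟩
  have hadj (A B : g.GoodNT) : (1 - jacobian u v).adjugate A B ∈ W := by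
    have : (1 - jacobian u v).adjugate = (1 - jacobian u' v').adjugate.map W.subtype := by
      have := W.subtype.map_adjugate (1 - jacobian u' v')
      rw [map_sub, map_one, RingHom.mapMatrix_apply, RingHom.mapMatrix_apply,
        map_jacobian] at this
      exact this.symm
    rw [this]
    exact Subtype.property _
  have : (1 - jacobian u v).det • d (.nonterminal A) =
      ∑ B : g.GoodNT, (1 - jacobian u v).adjugate ⟨A, hA⟩ B •
        ∑ C : g.GoodNT, (1 - jacobian u v) B C • d (.nonterminal C.1) := by
    simp only [Finset.smul_sum, smul_smul]
    rw [Finset.sum_comm]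
    simp only [← Finset.sum_smul, ← Matrix.mul_apply, Matrix.adjugate_mul, Matrix.smul_apply,
      Matrix.one_apply, smul_eq_mul, mul_ite, mul_one, mul_zero, ite_smul, zero_smul,
      Finset.sum_ite_eq, Finset.mem_univ, if_true]
  rw [this]
  exact sum_mem fun B _ => hWV _ (hadj _ _) _ (key B)

end Solve

/-- A solution of the polynomial system of a grammar with nonvanishing Jacobian determinant is
algebraic over the field of the values of the terminals. -/
theorem isAlgebraic_of_det_ne_zero {K L : Type} [Field K] [Field L] [Algebra K L]
    {s : Symbol T g.NT → L} (hs : ∀ t, s (.terminal t) ∈ (algebraMap K L).range)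
    (h_bad : ∀ X, ¬ g.IsGood X → s X = 0)
    (h_sum : ∀ A, g.IsGood (.nonterminal A) →
      s (.nonterminal A) = ∑ r ∈ g.goodRules A, (r.output.map s).prod)
    (hdet : (1 - jacobian s s).det ≠ 0) (X : Symbol T g.NT) :
    IsAlgebraic K (s X) := by
  classical
  -- Differentiating the system shows that the differentials of the generators of `E` satisfy a
  -- homogeneous linear system with nonzero determinant, so they vanish. Thus `Ω[E⁄K]` is zero, and
  -- a finitely generated extension without differentials is separable algebraic.
  let E := IntermediateField.adjoin K (Set.range fun A : g.GoodNT => s (.nonterminal A.1))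
  have hE (X : Symbol T g.NT) : s X ∈ E := by
    rcases X with t | A
    · obtain ⟨k, hk⟩ := hs t
      rw [← hk]
      exact E.algebraMap_mem k
    · by_cases hA : g.IsGood (.nonterminal A)
      · exact IntermediateField.subset_adjoin _ _ ⟨⟨A, hA⟩, rfl⟩
      · rw [h_bad _ hA]
        exact E.zero_mem
  let s' : Symbol T g.NT → E := fun X => ⟨s X, hE X⟩
  let D := KaehlerDifferential.D K E
  have hdet' : (1 - jacobian s' s').det ≠ 0 := by
    intro h
    have := map_det_one_sub_jacobian (algebraMap E L) s' s'
    rw [h, map_zero] at this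
    exact hdet this.symm
  have hD (X : Symbol T g.NT) : D (s' X) = 0 := by
    rcases X with t | A
    · obtain ⟨k, hk⟩ := hs t
      have : s' (.terminal t) = algebraMap K E k := Subtype.ext hk.symm
      rw [this, D.map_algebraMap]
    by_cases hA : g.IsGood (.nonterminal A)
    swap
    · have : s' (.nonterminal A) = 0 := Subtype.ext (h_bad _ hA)
      rw [this, D.map_zero]
    have := det_smul_mem (g := g) (S := E) (M := Ω[E⁄K]) (u := s') (v := s') (V := ⊥) ⊤
      (fun _ => trivial) (fun _ => trivial) (by simp +contextual)
      (h := fun α => D (α.map s').prod) (d := fun X => D (s' X)) (by simp) (by simp)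
      (fun t => ?_) (fun A hA => ?_) hA
    · exact (smul_eq_zero.1 (AddSubgroup.mem_bot.1 this)).resolve_left hdet'
    · obtain ⟨k, hk⟩ := hs t
      have : s' (.terminal t) = algebraMap K E k := Subtype.ext hk.symm
      rw [this, D.map_algebraMap]
      exact zero_mem _
    · rw [← map_sum]
      congr 1
      apply Subtype.ext
      change s _ = E.val _
      rw [h_sum A hA, map_sum]
      refine Finset.sum_congr rfl fun r _ => ?_
      rw [map_list_prod, List.map_map]
      rfl
  have hD' (x : L) (hx : x ∈ E) : D ⟨x, hx⟩ = 0 := by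
    induction hx using IntermediateField.adjoin_induction with
    | mem x hx =>
      obtain ⟨A, rfl⟩ := hx
      exact hD _
    | algebraMap x => exact D.map_algebraMap x
    | add x y hx hy h h' =>
      have := D.map_add ⟨x, hx⟩ ⟨y, hy⟩
      rw [h, h', add_zero] at this
      exact this
    | inv x hx h =>
      have := D.leibniz_inv (⟨x, hx⟩ : E)
      rw [h, smul_zero] at this
      exact this
    | mul x y hx hy h h' =>
      have := D.leibniz (⟨x, hx⟩ : E) ⟨y, hy⟩
      rw [h, h', smul_zero, smul_zero, add_zero] at this
      exact this
  have : Algebra.FormallyUnramified K E := by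
    refine ⟨Submodule.subsingleton_iff E |>.1 (subsingleton_of_bot_eq_top ?_)⟩
    rw [← KaehlerDifferential.span_range_derivation, eq_comm, Submodule.span_eq_bot]
    rintro _ ⟨x, rfl⟩
    exact hD' x.1 x.2
  have : Algebra.EssFiniteType K E :=
    IntermediateField.essFiniteType_iff.2 (IntermediateField.fg_adjoin_of_finite (Set.toFinite _))
  have : Algebra.IsSeparable K E := Algebra.FormallyUnramified.isSeparable K E
  exact (Algebra.IsAlgebraic.isAlgebraic (R := K) (s' X)).algebraMap (A := L)

end ContextFreeGrammar

/-! ### Generating matrices of the symbols of a grammar -/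

/-- Power series in three variables over the field with two elements. -/
abbrev SeriesF2 : Type := MvPowerSeries (Fin 3) (ZMod 2)

namespace ContextFreeGrammar

open scoped MvPowerSeries.WithPiTopology

variable {T : Type*} {g : ContextFreeGrammar T} {M : T → Matrix (Fin 3) (Fin 3) SeriesF2}

/-- The product of the matrices of the letters of a word. -/
noncomputable def wordMatrix (M : T → Matrix (Fin 3) (Fin 3) SeriesF2) (w : List T) :
    Matrix (Fin 3) (Fin 3) SeriesF2 :=
  (w.map M).prod

/-- Every monomial occurs in the matrices of finitely many words only. -/
def IsLocallyFinite (M : T → Matrix (Fin 3) (Fin 3) SeriesF2) : Prop :=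
  ∀ m i j, {w : List T | MvPowerSeries.coeff m (wordMatrix M w i j) ≠ 0}.Finite

/-- The discrete topology on the field with two elements. -/
abbrev discreteTopologyF2 : TopologicalSpace (ZMod 2) := ⊥

attribute [local instance] discreteTopologyF2

local instance : DiscreteTopology (ZMod 2) := ⟨rfl⟩

lemma t3Space_matrix : T3Space (Matrix (Fin 3) (Fin 3) SeriesF2) :=
  inferInstanceAs (T3Space (Fin 3 → Fin 3 → (Fin 3 →₀ ℕ) → ZMod 2))

lemma IsLocallyFinite.summable (hM : IsLocallyFinite M) {Z : Type*} {y : Z → List T}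
    (hy : ∀ w, {z | y z = w}.Finite) : Summable fun z => wordMatrix M (y z) := by
  refine Pi.summable.2 fun i => Pi.summable.2 fun j => ?_
  refine MvPowerSeries.WithPiTopology.summable_iff_summable_coeff.2 fun m => ?_
  refine summable_of_hasFiniteSupport
    (((hM m i j).biUnion (t := fun w => {z | y z = w}) fun w _ => hy w).subset fun z hz => ?_)
  exact Set.mem_biUnion (x := y z) hz rfl

/-- The sum of the matrices of the yields of all parse trees of a good symbol. -/
noncomputable def genMatrix (g : ContextFreeGrammar T)
    (M : T → Matrix (Fin 3) (Fin 3) SeriesF2) (X : Symbol T g.NT) :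
    Matrix (Fin 3) (Fin 3) SeriesF2 :=
  open Classical in if g.IsGood X then ∑' t : g.ParseTree X, wordMatrix M t.yield else 0

lemma genMatrix_of_not_isGood {X : Symbol T g.NT} (hX : ¬ g.IsGood X) : g.genMatrix M X = 0 :=
  if_neg hX

lemma hasSum_genMatrix (hM : IsLocallyFinite M) {X : Symbol T g.NT} (hX : g.IsGood X) :
    HasSum (fun t : g.ParseTree X => wordMatrix M t.yield) (g.genMatrix M X) := by
  rw [genMatrix, if_pos hX]
  exact (hM.summable hX.2).hasSum

lemma genMatrix_terminal (hM : IsLocallyFinite M) (t : T) :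
    g.genMatrix M (.terminal t) = M t := by
  refine (hasSum_genMatrix hM (isGood_terminal t)).unique ?_
  have := hasSum_unique fun s : g.ParseTree (.terminal t) => wordMatrix M s.yield
  rwa [show (default : g.ParseTree (.terminal t)) = .leaf t from rfl, ParseTree.yield_leaf,
    show wordMatrix M [t] = M t by simp [wordMatrix]] at this

/-- A word has only finitely many splittings into two factors. -/
lemma finite_append_fiber {Y Z : Type*} {y : Y → List T} {z : Z → List T}
    (hy : ∀ w, {p | y p = w}.Finite) (hz : ∀ w, {p | z p = w}.Finite) (w : List T) :
    {p : Y × Z | y p.1 ++ z p.2 = w}.Finite := by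
  refine ((Finset.range (w.length + 1)).finite_toSet.biUnion
    (t := fun n => {p | y p = w.take n} ×ˢ {p | z p = w.drop n})
    fun n _ => (hy _).prod (hz _)).subset ?_
  rintro p rfl
  refine Set.mem_biUnion (x := (y p.1).length) ?_ ?_
  · simp
  · simp

lemma finite_forest_fiber {α : List (Symbol T g.NT)} (hα : ∀ X ∈ α, g.IsGood X) (w : List T) :
    {f : g.Forest α | f.yield = w}.Finite := by
  induction α generalizing w with
  | nil => exact Set.toFinite _
  | cons X α ih =>
    have := finite_append_fiber (hα X (by simp)).2
      (ih fun Y hY => hα Y (List.mem_cons_of_mem _ hY)) w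
    refine (this.image (Forest.consEquiv X α)).subset fun f hf => ?_
    obtain ⟨p, rfl⟩ := (Forest.consEquiv X α).surjective f
    exact ⟨p, (Forest.yield_consEquiv p).symm.trans hf, rfl⟩

lemma hasSum_forest (hM : IsLocallyFinite M) {α : List (Symbol T g.NT)}
    (hα : ∀ X ∈ α, g.IsGood X) :
    HasSum (fun f : g.Forest α => wordMatrix M f.yield) (α.map (g.genMatrix M)).prod := by
  induction α with
  | nil =>
    simp [wordMatrix]
  | cons X α ih =>
    have hX := hα X (by simp)
    have hα' := fun Y hY => hα Y (List.mem_cons_of_mem X hY)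
    rw [← (Forest.consEquiv X α).hasSum_iff, List.map_cons, List.prod_cons]
    have h_eq : (fun f : g.Forest (X :: α) => wordMatrix M f.yield) ∘ Forest.consEquiv X α =
        fun p => wordMatrix M p.1.yield * wordMatrix M p.2.yield := by
      funext p
      simp [Forest.yield_consEquiv, wordMatrix]
    have h_sum := hM.summable (finite_forest_fiber hα)
    rw [← (Forest.consEquiv X α).summable_iff, h_eq] at h_sum
    rw [h_eq]
    have := t3Space_matrix
    exact HasSum.mul (f := fun t : g.ParseTree X => wordMatrix M t.yield)
      (g := fun f : g.Forest α => wordMatrix M f.yield) (hasSum_genMatrix hM hX) (ih hα') h_sum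

lemma genMatrix_nonterminal (hM : IsLocallyFinite M) {A : g.NT}
    (hA : g.IsGood (.nonterminal A)) :
    g.genMatrix M (.nonterminal A) =
      ∑ r ∈ g.goodRules A, (r.output.map (g.genMatrix M)).prod := by
  classical
  have h := hasSum_genMatrix hM hA
  rw [← (ParseTree.sigmaEquiv A).hasSum_iff] at h
  have hfib (r : {r : ContextFreeRule T g.NT // r ∈ g.rules ∧ r.input = A}) :
      HasSum (fun f : g.Forest r.1.output =>
        wordMatrix M (ParseTree.sigmaEquiv A ⟨r, f⟩).yield)
        (if ∀ X ∈ r.1.output, g.IsGood X then (r.1.output.map (g.genMatrix M)).prod else 0) := by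
    simp only [ParseTree.yield_sigmaEquiv]
    split_ifs with hr
    · exact hasSum_forest hM hr
    -- A rule with a bad symbol contributes an empty sum, which is why the sum may be restricted to
    -- `goodRules`.
    · have : IsEmpty (g.Forest r.1.output) :=
        ⟨fun f => hr (IsGood.of_forest (by rwa [r.2.2]) r.2.1 f)⟩
      exact hasSum_empty
  have : Fintype {r : ContextFreeRule T g.NT // r ∈ g.rules ∧ r.input = A} :=
    have : Finite {r : ContextFreeRule T g.NT // r ∈ g.rules ∧ r.input = A} :=
      Set.Finite.subset (s := g.rules) g.rules.finite_toSet fun r hr => hr.1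
    Fintype.ofFinite _
  rw [(h.sigma hfib).unique (hasSum_fintype _), ← Finset.sum_filter]
  refine Finset.sum_bij (fun r _ => r.1) ?_ ?_ ?_ ?_
  · intro r hr
    exact mem_goodRules.2 ⟨r.2.1, r.2.2, (Finset.mem_filter.1 hr).2⟩
  · exact fun r _ s _ h => Subtype.ext h
  · intro r hr
    obtain ⟨h₁, h₂, h₃⟩ := mem_goodRules.1 hr
    exact ⟨⟨r, h₁, h₂⟩, by simpa using h₃, rfl⟩
  · exact fun _ _ => rfl

lemma hasSum_coeff_genMatrix (hM : IsLocallyFinite M) {X : Symbol T g.NT} (hX : g.IsGood X)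
    (m : Fin 3 →₀ ℕ) (i j : Fin 3) :
    HasSum (fun t : g.ParseTree X => MvPowerSeries.coeff m (wordMatrix M t.yield i j))
      (MvPowerSeries.coeff m (g.genMatrix M X i j)) :=
  MvPowerSeries.WithPiTopology.hasSum_iff_hasSum_coeff.1
    (Pi.hasSum.1 (Pi.hasSum.1 (hasSum_genMatrix hM hX) i) j) m

lemma exists_coeff_ne_zero_of_genMatrix (hM : IsLocallyFinite M) {X : Symbol T g.NT}
    {m : Fin 3 →₀ ℕ} {i j : Fin 3} (h : MvPowerSeries.coeff m (g.genMatrix M X i j) ≠ 0) :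
    ∃ t : g.ParseTree X, MvPowerSeries.coeff m (wordMatrix M t.yield i j) ≠ 0 := by
  by_contra! h0
  by_cases hX : g.IsGood X
  · have := hasSum_coeff_genMatrix hM hX m i j
    simp only [h0] at this
    exact h (this.unique hasSum_zero)
  · exact h (by rw [genMatrix_of_not_isGood hX]; simp)

lemma coeff_genMatrix_congr (hM : IsLocallyFinite M) {X : Symbol T g.NT}
    {m : Fin 3 →₀ ℕ} {i j i' j' : Fin 3} (h : ∀ w, MvPowerSeries.coeff m (wordMatrix M w i j) =
      MvPowerSeries.coeff m (wordMatrix M w i' j')) :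
    MvPowerSeries.coeff m (g.genMatrix M X i j) =
      MvPowerSeries.coeff m (g.genMatrix M X i' j') := by
  by_cases hX : g.IsGood X
  · refine (hasSum_coeff_genMatrix hM hX m i j).unique ?_
    simpa only [h] using hasSum_coeff_genMatrix hM hX m i' j'
  · rw [genMatrix_of_not_isGood hX]; simp

lemma coeff_genMatrix_eq_ncard (hM : IsLocallyFinite M) {X : Symbol T g.NT} (hX : g.IsGood X)
    {m : Fin 3 →₀ ℕ} {i j : Fin 3} {w₀ : List T}
    (h : ∀ w, MvPowerSeries.coeff m (wordMatrix M w i j) =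
      open Classical in if w = w₀ then 1 else 0) :
    MvPowerSeries.coeff m (g.genMatrix M X i j) =
      ({t : g.ParseTree X | t.yield = w₀}.ncard : ZMod 2) := by
  refine (hasSum_coeff_genMatrix hM hX m i j).unique ?_
  simp only [h]
  have := hasSum_sum_of_ne_finset_zero (f := fun t : g.ParseTree X =>
    open Classical in if t.yield = w₀ then (1 : ZMod 2) else 0) (s := (hX.2 w₀).toFinset)
    (L := .unconditional _) (by simp)
  rwa [Finset.sum_congr rfl (g := fun _ => (1 : ZMod 2)) (by simp +contextual),
    Finset.sum_const, nsmul_one, ← Set.ncard_eq_toFinset_card _ (hX.2 w₀)] at this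

end ContextFreeGrammar

/-! ### Subalgebras of the power series ring -/

lemma IsAlgebraic.of_subalgebra_le {R A : Type*} [CommRing R] [CommRing A] [Algebra R A]
    {S S' : Subalgebra R A} (h : S ≤ S') {x : A} (hx : IsAlgebraic S x) : IsAlgebraic S' x := by
  obtain ⟨p, hp, h0⟩ := hx
  let f : S →+* S' := (Subalgebra.inclusion h).toRingHom
  have hf : Function.Injective f := Subalgebra.inclusion_injective h
  have hcomp : (algebraMap S' A).comp f = algebraMap S A := rfl
  refine ⟨p.map f, (Polynomial.map_ne_zero_iff hf).2 hp, ?_⟩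
  rw [Polynomial.aeval_def, Polynomial.eval₂_map, hcomp]
  exact h0

namespace SeriesF2

open MvPowerSeries

instance : IsDomain SeriesF2 := NoZeroDivisors.to_isDomain _

/-- The polynomials in the variables from `σ`. -/
noncomputable def polySub (σ : Set (Fin 3)) : Subalgebra (ZMod 2) SeriesF2 :=
  (MvPolynomial.supported (ZMod 2) σ).map (MvPolynomial.coeToMvPowerSeries.algHom (ZMod 2))

lemma mem_polySub {σ : Set (Fin 3)} {x : SeriesF2} :
    x ∈ polySub σ ↔ ∃ p ∈ MvPolynomial.supported (ZMod 2) σ, (p : SeriesF2) = x := by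
  simp [polySub]

lemma X_mem_polySub {σ : Set (Fin 3)} {i : Fin 3} (hi : i ∈ σ) :
    (X i : SeriesF2) ∈ polySub σ :=
  mem_polySub.2 ⟨MvPolynomial.X i, Algebra.subset_adjoin ⟨i, hi, rfl⟩, MvPolynomial.coe_X i⟩

lemma polySub_eq_adjoin (σ : Set (Fin 3)) :
    polySub σ = Algebra.adjoin (ZMod 2) ((X : Fin 3 → SeriesF2) '' σ) := by
  rw [polySub, MvPolynomial.supported_eq_adjoin_X, AlgHom.map_adjoin, Set.image_image]
  simp

lemma polySub_mono {σ τ : Set (Fin 3)} (h : σ ⊆ τ) : polySub σ ≤ polySub τ :=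
  Subalgebra.map_mono (MvPolynomial.supported_mono h)

/-- The power series in which only the variables from `σ` occur. -/
def supportedSub (σ : Set (Fin 3)) : Subalgebra (ZMod 2) SeriesF2 where
  carrier := {f | ∀ m, coeff m f ≠ 0 → (m.support : Set (Fin 3)) ⊆ σ}
  mul_mem' {f h} hf hh m hm := by
    classical
    rw [coeff_mul] at hm
    obtain ⟨p, hp, hne⟩ := Finset.exists_ne_zero_of_sum_ne_zero hm
    rw [← Finset.HasAntidiagonal.mem_antidiagonal.1 hp]
    refine subset_trans (Finset.coe_subset.2 Finsupp.support_add) ?_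
    rw [Finset.coe_union]
    exact Set.union_subset (hf _ (left_ne_zero_of_mul hne)) (hh _ (right_ne_zero_of_mul hne))
  add_mem' {f h} hf hh m hm := by
    rw [map_add] at hm
    by_cases h0 : coeff m f = 0
    · rw [h0, zero_add] at hm
      exact hh m hm
    · exact hf m h0
  algebraMap_mem' r m hm := by
    classical
    rw [MvPowerSeries.algebraMap_apply, coeff_C] at hm
    split_ifs at hm with h
    · simp [h]
    · exact absurd rfl hm

lemma supportedSub_mono {σ τ : Set (Fin 3)} (h : σ ⊆ τ) : supportedSub σ ≤ supportedSub τ :=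
  fun _ hf m hm => (hf m hm).trans h

/-- The power series that are algebraic over the polynomials in the variables from `σ`. -/
noncomputable def algSub (σ : Set (Fin 3)) : Subalgebra (ZMod 2) SeriesF2 :=
  (Subalgebra.algebraicClosure (polySub σ) SeriesF2).restrictScalars (ZMod 2)

lemma mem_algSub {σ : Set (Fin 3)} {x : SeriesF2} : x ∈ algSub σ ↔ IsAlgebraic (polySub σ) x :=
  Iff.rfl

lemma algSub_mono {σ τ : Set (Fin 3)} (h : σ ⊆ τ) : algSub σ ≤ algSub τ := by
  intro x hx
  exact mem_algSub.2 ((mem_algSub.1 hx).of_subalgebra_le (polySub_mono h))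

lemma polySub_le_algSub (σ : Set (Fin 3)) : polySub σ ≤ algSub σ :=
  fun x hx => isAlgebraic_algebraMap (⟨x, hx⟩ : polySub σ)

/-- The algebraic power series in the variable `i`. -/
noncomputable def algVar (i : Fin 3) : Subalgebra (ZMod 2) SeriesF2 :=
  algSub {i} ⊓ supportedSub {i}

/-- The subalgebra generated by the algebraic power series in one variable from `σ`. -/
noncomputable def algTensor (σ : Set (Fin 3)) : Subalgebra (ZMod 2) SeriesF2 :=
  ⨆ i ∈ σ, algVar i

lemma algVar_le_algTensor {σ : Set (Fin 3)} {i : Fin 3} (hi : i ∈ σ) : algVar i ≤ algTensor σ :=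
  le_iSup₂_of_le i hi le_rfl

lemma algTensor_mono {σ τ : Set (Fin 3)} (h : σ ⊆ τ) : algTensor σ ≤ algTensor τ :=
  iSup₂_le fun _ hi => algVar_le_algTensor (h hi)

lemma algTensor_le_algSub (σ : Set (Fin 3)) : algTensor σ ≤ algSub σ :=
  iSup₂_le fun _ hi => inf_le_left.trans (algSub_mono (Set.singleton_subset_iff.2 hi))

lemma algTensor_le_supportedSub (σ : Set (Fin 3)) : algTensor σ ≤ supportedSub σ :=
  iSup₂_le fun _ hi => inf_le_right.trans (supportedSub_mono (Set.singleton_subset_iff.2 hi))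

lemma X_mem_algVar (i : Fin 3) : (X i : SeriesF2) ∈ algVar i := by
  classical
  refine ⟨polySub_le_algSub _ (X_mem_polySub rfl), fun m hm => ?_⟩
  rw [coeff_X] at hm
  split_ifs at hm with h
  · rw [h]
    simp
  · exact absurd rfl hm

lemma polySub_le_algTensor (σ : Set (Fin 3)) : polySub σ ≤ algTensor σ := by
  rw [polySub_eq_adjoin, Algebra.adjoin_le_iff]
  rintro _ ⟨i, hi, rfl⟩
  exact algVar_le_algTensor hi (X_mem_algVar i)

/-- Rationalising a denominator: a nonzero algebraic element of a domain has a nonzero polynomial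
multiple, and the cofactor can be taken in the algebra generated by `x`. -/
lemma exists_mul_mem_polySub {σ : Set (Fin 3)} {x : SeriesF2} (hx : x ∈ algTensor σ)
    (h0 : x ≠ 0) : ∃ y ∈ algTensor σ, x * y ∈ polySub σ ∧ x * y ≠ 0 := by
  obtain ⟨y, hy, p, hp, h⟩ := IsAlgebraic.exists_nonzero_eq_adjoin_mul
    (mem_algSub.1 (algTensor_le_algSub σ hx)) (mem_nonZeroDivisors_of_ne_zero h0)
  refine ⟨y, ?_, h ▸ p.2, h ▸ fun h' => hp (Subtype.ext h')⟩
  clear h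
  induction hy using Algebra.adjoin_induction with
  | mem y hy => rwa [Set.mem_singleton_iff.1 hy]
  | algebraMap q => exact polySub_le_algTensor σ q.2
  | add _ _ _ _ h h' => exact add_mem h h'
  | mul _ _ _ _ h h' => exact mul_mem h h'

/-! ### Fractions with restricted denominators -/

/-- The nonzero polynomials in the variables from `σ`. -/
noncomputable def polyNonzero (σ : Set (Fin 3)) : Submonoid SeriesF2 :=
  (polySub σ).toSubmonoid ⊓ nonZeroDivisors SeriesF2

lemma mem_polyNonzero {σ : Set (Fin 3)} {x : SeriesF2} :
    x ∈ polyNonzero σ ↔ x ∈ polySub σ ∧ x ≠ 0 := by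
  simp [polyNonzero]

/-- The power series that are fractions with a numerator in `W` and a denominator in `P`. -/
def fractions (P : Submonoid SeriesF2) (W : Subalgebra (ZMod 2) SeriesF2)
    (h : P ≤ W.toSubmonoid) : Subalgebra (ZMod 2) SeriesF2 where
  carrier := {x | ∃ p ∈ P, p * x ∈ W}
  mul_mem' := by
    rintro x y ⟨p, hp, hx⟩ ⟨q, hq, hy⟩
    exact ⟨p * q, mul_mem hp hq, by rw [mul_mul_mul_comm]; exact mul_mem hx hy⟩
  add_mem' := by
    rintro x y ⟨p, hp, hx⟩ ⟨q, hq, hy⟩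
    refine ⟨p * q, mul_mem hp hq, ?_⟩
    rw [show p * q * (x + y) = q * (p * x) + p * (q * y) by ring]
    exact add_mem (mul_mem (h hq) hx) (mul_mem (h hp) hy)
  algebraMap_mem' r := ⟨1, one_mem _, by rw [one_mul]; exact W.algebraMap_mem r⟩

section Fractions

variable {P Q : Submonoid SeriesF2} {V W : Subalgebra (ZMod 2) SeriesF2}
  {hP : P ≤ W.toSubmonoid} {hQ : Q ≤ V.toSubmonoid}

lemma le_fractions : W ≤ fractions P W hP := fun x hx => ⟨1, one_mem _, by rwa [one_mul]⟩

lemma fractions_mono (hQP : Q ≤ P) (hVW : V ≤ W) : fractions Q V hQ ≤ fractions P W hP :=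
  fun _ ⟨p, hp, h⟩ => ⟨p, hQP hp, hVW h⟩

lemma mem_fractions_of_mul_mem {σ : Set (Fin 3)} (hσP : polyNonzero σ ≤ P)
    (hσW : algTensor σ ≤ W) {d x : SeriesF2} (hd : d ∈ algTensor σ) (h0 : d ≠ 0)
    (h : d * x ∈ fractions P W hP) : x ∈ fractions P W hP := by
  obtain ⟨y, hy, hp, hp0⟩ := exists_mul_mem_polySub hd h0
  obtain ⟨q, hq, h⟩ := h
  refine ⟨d * y * q, mul_mem (hσP (mem_polyNonzero.2 ⟨hp, hp0⟩)) hq, ?_⟩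
  rw [show d * y * q * x = y * (q * (d * x)) by ring]
  exact mul_mem (hσW hy) h

end Fractions

lemma polyNonzero_le (σ : Set (Fin 3)) : polyNonzero σ ≤ (algTensor σ).toSubmonoid :=
  fun _ hx => polySub_le_algTensor σ (mem_polyNonzero.1 hx).1

/-- Fractions with a denominator that is a polynomial in the variables from `σ`. -/
noncomputable def fractionSub (σ : Set (Fin 3)) : Subalgebra (ZMod 2) SeriesF2 :=
  fractions (polyNonzero σ) (algTensor σ) (polyNonzero_le σ)

/-- Products of nonzero polynomials in two variables. -/
noncomputable def pairDenominators : Submonoid SeriesF2 :=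
  polyNonzero {0, 1} ⊔ polyNonzero {1, 2} ⊔ polyNonzero {0, 2}

lemma pairDenominators_le : pairDenominators ≤ (algTensor Set.univ).toSubmonoid :=
  have h (σ) : polyNonzero σ ≤ (algTensor Set.univ).toSubmonoid :=
    (polyNonzero_le σ).trans (algTensor_mono (Set.subset_univ σ))
  sup_le (sup_le (h _) (h _)) (h _)

/-- Fractions with a denominator that is a product of polynomials in two variables. -/
noncomputable def pairFractions : Subalgebra (ZMod 2) SeriesF2 :=
  fractions pairDenominators (algTensor Set.univ) pairDenominators_le

end SeriesF2

/-! ### The geometric series in the product of the variables -/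

namespace SeriesF2

open MvPowerSeries

/-- The exponent vector of the monomial with the given three exponents. -/
noncomputable def expo (n j k : ℕ) : Fin 3 →₀ ℕ := Finsupp.equivFunOnFinite.symm ![n, j, k]

@[simp] lemma expo_zero (n j k : ℕ) : expo n j k 0 = n := rfl
@[simp] lemma expo_one (n j k : ℕ) : expo n j k 1 = j := rfl
@[simp] lemma expo_two (n j k : ℕ) : expo n j k 2 = k := rfl

lemma exponent_ext_iff {m m' : Fin 3 →₀ ℕ} : m = m' ↔ m 0 = m' 0 ∧ m 1 = m' 1 ∧ m 2 = m' 2 := by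
  rw [Finsupp.ext_iff]
  exact Fin.forall_fin_succ.trans (and_congr_right fun _ => Fin.forall_fin_two)

lemma exponent_le_iff {m m' : Fin 3 →₀ ℕ} : m ≤ m' ↔ m 0 ≤ m' 0 ∧ m 1 ≤ m' 1 ∧ m 2 ≤ m' 2 :=
  Fin.forall_fin_succ.trans (and_congr_right fun _ => Fin.forall_fin_two)

/-- The coefficients of a power series at the monomials of degree `n` in the first variable. -/
noncomputable def slice (n : ℕ) : SeriesF2 →ₗ[ZMod 2] (ℕ × ℕ → ZMod 2) :=
  LinearMap.pi fun p => coeff (expo n p.1 p.2)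

lemma slice_apply (n : ℕ) (x : SeriesF2) (p : ℕ × ℕ) :
    slice n x p = coeff (expo n p.1 p.2) x := rfl

/-- The variables are separated, so only one splitting of the exponent contributes. All slices of
such a product are multiples of a single one. -/
lemma slice_mul {x y : SeriesF2} (hx : x ∈ supportedSub {0}) (hy : y ∈ supportedSub {1, 2})
    (n : ℕ) : slice n (x * y) = coeff (expo n 0 0) x • slice 0 y := by
  classical
  funext p
  rw [Pi.smul_apply, slice_apply, slice_apply, coeff_mul, smul_eq_mul]
  refine Finset.sum_eq_single (expo n 0 0, expo 0 p.1 p.2) ?_ ?_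
  · rintro ⟨m, m'⟩ hm hne
    by_contra h0
    have h := hx _ (left_ne_zero_of_mul h0)
    have h' := hy _ (right_ne_zero_of_mul h0)
    have h1 : m 1 = 0 := by
      by_contra h1
      simpa using h (Finsupp.mem_support_iff.2 h1)
    have h2 : m 2 = 0 := by
      by_contra h2
      simpa using h (Finsupp.mem_support_iff.2 h2)
    have h0' : m' 0 = 0 := by
      by_contra h0'
      simpa using h' (Finsupp.mem_support_iff.2 h0')
    have hm := Finset.HasAntidiagonal.mem_antidiagonal.1 hm
    simp only [exponent_ext_iff, Finsupp.add_apply, expo_zero, expo_one, expo_two] at hm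
    refine hne (Prod.ext (exponent_ext_iff.2 ?_) (exponent_ext_iff.2 ?_)) <;>
      simp only [expo_zero, expo_one, expo_two] <;> lia
  · intro h
    refine absurd (Finset.HasAntidiagonal.mem_antidiagonal.2 (exponent_ext_iff.2 ?_)) h
    simp

/-- A power series has finite rank if its slices span a finite-dimensional space. -/
def HasFiniteRank (x : SeriesF2) : Prop :=
  ∃ V : Submodule (ZMod 2) (ℕ × ℕ → ZMod 2), FiniteDimensional (ZMod 2) V ∧ ∀ n, slice n x ∈ V

lemma algTensor_univ : algTensor Set.univ ≤ algVar 0 ⊔ algTensor {1, 2} := by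
  refine iSup₂_le fun i _ => ?_
  fin_cases i
  · exact le_sup_left
  · exact (algVar_le_algTensor (by simp)).trans le_sup_right
  · exact (algVar_le_algTensor (by simp)).trans le_sup_right

/-- Such a series is a finite sum of products of a series in `x₀` and a series in `x₁, x₂`, each
product having rank at most one. -/
lemma hasFiniteRank_of_mem_algTensor {x : SeriesF2} (hx : x ∈ algTensor Set.univ) :
    HasFiniteRank x := by
  replace hx : x ∈ Subalgebra.toSubmodule (supportedSub {0} ⊔ supportedSub {1, 2}) :=
    (algTensor_univ.trans (sup_le_sup inf_le_right (algTensor_le_supportedSub _))) hx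
  rw [← Subalgebra.mul_toSubmodule] at hx
  induction hx using Submodule.mul_induction_on' with
  | mem_mul_mem x hx y hy =>
    refine ⟨Submodule.span _ {slice 0 y}, inferInstance, fun n => ?_⟩
    rw [slice_mul hx hy]
    exact Submodule.smul_mem _ _ (Submodule.mem_span_singleton_self _)
  | add x _ y _ hx hy =>
    obtain ⟨V, hV, h⟩ := hx
    obtain ⟨V', hV', h'⟩ := hy
    refine ⟨V ⊔ V', inferInstance, fun n => ?_⟩
    rw [map_add]
    exact Submodule.add_mem_sup (h n) (h' n)

/-- The change of exponents for the substitution of the inverse of the product of the last two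
variables for the first variable. -/
def exponentHom : (Fin 3 →₀ ℕ) →+ ℤ × ℤ where
  toFun m := (m 1 - m 0, m 2 - m 0)
  map_zero' := by simp
  map_add' m m' := by ext <;> simp <;> ring

/-- The substitution of the inverse of the product of the last two variables for the first. -/
noncomputable def laurentHom :
    MvPolynomial (Fin 3) (ZMod 2) →+* AddMonoidAlgebra (ZMod 2) (ℤ × ℤ) :=
  AddMonoidAlgebra.mapDomainRingHom (ZMod 2) exponentHom

lemma laurentHom_monomial (d : Fin 3 →₀ ℕ) (r : ZMod 2) :
    laurentHom (MvPolynomial.monomial d r) = AddMonoidAlgebra.single (exponentHom d) r :=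
  AddMonoidAlgebra.mapDomain_single

/-- Distinct monomials of `p` have distinct images, so nothing cancels. -/
lemma laurentHom_ne_zero {σ : Set (Fin 3)}
    (hσ : Set.InjOn exponentHom {m | (m.support : Set (Fin 3)) ⊆ σ})
    {p : MvPolynomial (Fin 3) (ZMod 2)} (hp : p ∈ MvPolynomial.supported (ZMod 2) σ)
    (h0 : p ≠ 0) : laurentHom p ≠ 0 := by
  intro h
  let c : (Fin 3 →₀ ℕ) →₀ ZMod 2 := AddMonoidAlgebra.coeff p
  have hp' : (c.support : Set (Fin 3 →₀ ℕ)) ⊆ {m | (m.support : Set (Fin 3)) ⊆ σ} := by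
    intro m hm i hi
    exact MvPolynomial.mem_supported.1 hp
      (MvPolynomial.mem_vars_iff_mem_support i |>.2 ⟨m, hm, hi⟩)
  have h' : Finsupp.mapDomain exponentHom c = Finsupp.mapDomain exponentHom 0 := by
    rw [Finsupp.mapDomain_zero]
    exact congrArg AddMonoidAlgebra.coeff h
  exact h0 (AddMonoidAlgebra.coeff_injective (Finsupp.mapDomain_injOn _ hσ hp' (by simp) h'))

lemma exists_laurentHom_ne_zero {x : SeriesF2} (hx : x ∈ pairDenominators) :
    ∃ p : MvPolynomial (Fin 3) (ZMod 2), (p : SeriesF2) = x ∧ laurentHom p ≠ 0 := by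
  let Q : Submonoid SeriesF2 :=
    { carrier := {x | ∃ p : MvPolynomial (Fin 3) (ZMod 2), (p : SeriesF2) = x ∧ laurentHom p ≠ 0}
      one_mem' := ⟨1, by simp, by rw [map_one]; exact one_ne_zero⟩
      mul_mem' := by
        rintro _ _ ⟨p, rfl, hp⟩ ⟨q, rfl, hq⟩
        exact ⟨p * q, by simp, by rw [map_mul]; exact mul_ne_zero hp hq⟩ }
  -- When the exponent of one variable is zero, the differences `m 1 - m 0` and `m 2 - m 0`
  -- determine the other two. Products stay nonzero because the Laurent polynomial ring is a domain.
  have key (σ : Set (Fin 3)) (i : Fin 3) (hi : i ∉ σ) : polyNonzero σ ≤ Q := by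
    rintro x hx
    obtain ⟨hx, h0⟩ := mem_polyNonzero.1 hx
    obtain ⟨p, hp, rfl⟩ := mem_polySub.1 hx
    refine ⟨p, rfl, laurentHom_ne_zero ?_ hp fun h => h0 (by simp [h])⟩
    intro m hm m' hm' h
    have hmi : m i = 0 := by
      by_contra h
      exact hi (hm (Finsupp.mem_support_iff.2 h))
    have hmi' : m' i = 0 := by
      by_contra h
      exact hi (hm' (Finsupp.mem_support_iff.2 h))
    have h1 : (m 1 : ℤ) - m 0 = m' 1 - m' 0 := congrArg Prod.fst h
    have h2 : (m 2 : ℤ) - m 0 = m' 2 - m' 0 := congrArg Prod.snd h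
    rw [exponent_ext_iff]
    fin_cases i <;> simp only [Fin.reduceFinMk, Fin.zero_eta, Fin.mk_one] at hmi hmi' <;> lia
  have : pairDenominators ≤ Q := sup_le (sup_le (key _ 2 (by simp)) (key _ 0 (by simp)))
    (key _ 1 (by simp))
  exact this hx

/-- The power series whose coefficients are the indicator of the predicate `P`. -/
noncomputable def indicator (P : (Fin 3 →₀ ℕ) → Prop) : SeriesF2 :=
  fun m => open Classical in if P m then 1 else 0

lemma coeff_indicator (P : (Fin 3 →₀ ℕ) → Prop) (m : Fin 3 →₀ ℕ) :
    coeff m (indicator P) = open Classical in if P m then 1 else 0 := rfl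

/-- The sum of the positive powers of the product of the three variables. -/
noncomputable def diagSeries : SeriesF2 := indicator fun m => m 0 = m 1 ∧ m 1 = m 2 ∧ 1 ≤ m 0

/-- For `n` above the `x₀`-degree of `p`, each monomial of `p` meets exactly one power of `x₀x₁x₂`
that brings the `x₀`-exponent to `n`. Thus the slice at `n` is the Laurent polynomial `laurentHom p`
shifted by `(n, n)`. -/
lemma exists_coeff_mul_diagSeries (p : MvPolynomial (Fin 3) (ZMod 2)) :
    ∃ D, ∀ n ≥ D, ∀ j k, coeff (expo n j k) ((p : SeriesF2) * diagSeries) =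
      (laurentHom p).coeff ((j : ℤ) - n, (k : ℤ) - n) := by
  classical
  induction p using MvPolynomial.induction_on' with
  | monomial d r =>
    refine ⟨d 0 + 1, fun n hn j k => ?_⟩
    rw [MvPolynomial.coe_monomial, coeff_monomial_mul, laurentHom_monomial, diagSeries,
      coeff_indicator, AddMonoidAlgebra.coeff_single, Finsupp.single_apply]
    have h1 : exponentHom d = ((j : ℤ) - n, (k : ℤ) - n) ↔
        (d 1 : ℤ) - d 0 = j - n ∧ (d 2 : ℤ) - d 0 = k - n := Prod.ext_iff
    simp only [mul_ite, mul_one, mul_zero, ← ite_and]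
    refine if_congr ?_ rfl rfl
    rw [h1]
    simp only [exponent_le_iff, expo_zero, expo_one, expo_two, Finsupp.tsub_apply]
    lia
  | add p q hp hq =>
    obtain ⟨D, hD⟩ := hp
    obtain ⟨D', hD'⟩ := hq
    refine ⟨max D D', fun n hn j k => ?_⟩
    rw [MvPolynomial.coe_add, add_mul, map_add, hD n (le_of_max_le_left hn),
      hD' n (le_of_max_le_right hn), map_add, AddMonoidAlgebra.coeff_add, Finsupp.add_apply]

/-- The geometric series in the product of the variables is not a fraction with a denominator
that is a product of polynomials in two variables. -/
theorem diagSeries_notMem_pairFractions : diagSeries ∉ pairFractions := by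
  rintro ⟨x, hx, h⟩
  obtain ⟨p, rfl, hp⟩ := exists_laurentHom_ne_zero hx
  obtain ⟨V, hV, hslice⟩ := hasFiniteRank_of_mem_algTensor h
  obtain ⟨D, hD⟩ := exists_coeff_mul_diagSeries p
  set e := (laurentHom p).coeff with he
  have he0 : e.support.Nonempty := by
    rw [Finsupp.support_nonempty_iff]
    exact fun h => hp (AddMonoidAlgebra.coeff_injective h)
  -- The shifts of a nonzero Laurent polynomial are independent: in a linear relation, the extreme
  -- exponent of the largest shift `M` cannot cancel. The offset `N` passes the threshold `D` and
  -- makes the exponents `j` and `k` below nonnegative.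
  obtain ⟨⟨u, v⟩, huv, hmax⟩ := Finset.exists_max_image e.support Prod.fst he0
  let N := D + u.natAbs + v.natAbs
  have hdep : ¬ LinearIndependent (ZMod 2)
      fun n : ℕ => (⟨slice (N + n) ((p : SeriesF2) * diagSeries), hslice _⟩ : V) := by
    intro hli
    have := hli.finite
    exact not_finite ℕ
  rw [linearIndependent_iff] at hdep
  push Not at hdep
  obtain ⟨l, hl, hl0⟩ := hdep
  have hl0' : l.support.Nonempty := Finsupp.support_nonempty_iff.2 hl0
  set M := l.support.max' hl0' with hM
  obtain ⟨j, hj⟩ := Int.eq_ofNat_of_zero_le (a := u + N + M) (by lia)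
  obtain ⟨k, hk⟩ := Int.eq_ofNat_of_zero_le (a := v + N + M) (by lia)
  have hsum : l.sum (fun n r => r * e ((j : ℤ) - (N + n : ℕ), (k : ℤ) - (N + n : ℕ))) = 0 := by
    have h := congrFun (congrArg Subtype.val hl) (j, k)
    rw [Finsupp.linearCombination_apply, Finsupp.sum, AddSubmonoidClass.coe_finsetSum,
      Finset.sum_apply] at h
    refine Eq.trans ?_ h
    refine Finset.sum_congr rfl fun n _ => ?_
    exact congrArg (l n * ·) (hD (N + n) (by lia) j k).symm
  rw [Finsupp.sum, Finset.sum_eq_single M] at hsum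
  · rw [show ((j : ℤ) - (N + M : ℕ), (k : ℤ) - (N + M : ℕ)) = (u, v) by ext <;> simp <;> lia]
      at hsum
    exact mul_ne_zero (Finsupp.mem_support_iff.1 (l.support.max'_mem hl0'))
      (Finsupp.mem_support_iff.1 huv) hsum
  · intro n hn hne
    -- For `n < M` the first exponent is `u + M - n`, which exceeds the maximum `u`.
    have hlt : n < M := lt_of_le_of_ne (l.support.le_max' n hn) hne
    rw [mul_eq_zero]
    right
    by_contra h0
    have := hmax _ (Finsupp.mem_support_iff.2 h0)
    simp only at this
    lia
  · exact fun h => absurd (l.support.max'_mem hl0') h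

end SeriesF2

/-! ### Algebraicity over subalgebras, and the automaton for the three letters -/

namespace ContextFreeGrammar

open MvPowerSeries SeriesF2

variable {T : Type*} {g : ContextFreeGrammar T}

/-- A solution in a domain of the polynomial system of a grammar with nonvanishing Jacobian
determinant is algebraic over every subalgebra that contains the values of the terminals. -/
theorem isAlgebraic_subalgebra_of_det_ne_zero {F R : Type} [CommRing F] [CommRing R] [IsDomain R]
    [Algebra F R] (S : Subalgebra F R) {s : Symbol T g.NT → R} (hs : ∀ t, s (.terminal t) ∈ S)
    (h_bad : ∀ X, ¬ g.IsGood X → s X = 0)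
    (h_sum : ∀ A, g.IsGood (.nonterminal A) →
      s (.nonterminal A) = ∑ r ∈ g.goodRules A, (r.output.map s).prod)
    (hdet : (1 - jacobian s s).det ≠ 0) (X : Symbol T g.NT) : IsAlgebraic S (s X) := by
  let L := FractionRing R
  have hinj : Function.Injective (algebraMap R L) := IsFractionRing.injective R L
  let K := FractionRing S
  let : Algebra K L := FractionRing.liftAlgebra S L
  have : IsScalarTower S K L := FractionRing.isScalarTower_liftAlgebra S L
  have key := isAlgebraic_of_det_ne_zero (g := g) (K := K) (L := L)
    (s := fun X => algebraMap R L (s X))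
    (fun t => ⟨algebraMap S K ⟨_, hs t⟩, by
      rw [← IsScalarTower.algebraMap_apply]; rfl⟩)
    (fun X hX => by rw [h_bad X hX, map_zero])
    (fun A hA => by
      simp only [h_sum A hA, map_sum, map_list_prod, List.map_map]
      rfl)
    (by
      rw [← map_det_one_sub_jacobian (algebraMap R L), Ne, map_eq_zero_iff _ hinj]
      exact hdet) X
  have key' : IsAlgebraic S (algebraMap R L (s X)) := (IsFractionRing.isAlgebraic_iff S K L).2 key
  exact (isAlgebraic_algebraMap_iff hinj).1 key'

lemma det_one_sub_jacobian_mem {S : Type*} [CommRing S] (W : Subring S) {u v : Symbol T g.NT → S}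
    (hu : ∀ X, u X ∈ W) (hv : ∀ X, v X ∈ W) : (1 - jacobian u v).det ∈ W := by
  rw [show (1 - jacobian u v).det = W.subtype
    (1 - jacobian (fun X => (⟨u X, hu X⟩ : W)) fun X => ⟨v X, hv X⟩).det from
      (map_det_one_sub_jacobian W.subtype (fun X => (⟨u X, hu X⟩ : W)) fun X => ⟨v X, hv X⟩).symm]
  exact Subtype.property _

/-! ### The matrices of the letters -/

/-- The transition matrix of a letter in the automaton with the three states `0`, `1`, `2`, in which
the letter `ℓ k` leads to the state `k`, from this state and from the preceding one. -/
noncomputable def letterMatrix (ℓ : Fin 3 → T) (t : T) : Matrix (Fin 3) (Fin 3) SeriesF2 :=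
  fun i k => open Classical in if t = ℓ k ∧ (k = i ∨ (k : ℕ) = i + 1) then X k else 0

lemma wordMatrix_nil {M : T → Matrix (Fin 3) (Fin 3) SeriesF2} : wordMatrix M [] = 1 := rfl

lemma wordMatrix_cons {M : T → Matrix (Fin 3) (Fin 3) SeriesF2} (t : T) (w : List T)
    (i j : Fin 3) : wordMatrix M (t :: w) i j = ∑ k, M t i k * wordMatrix M w k j := by
  simp [wordMatrix, Matrix.mul_apply]

variable {ℓ : Fin 3 → T}

lemma coeff_wordMatrix_ne_zero {w : List T} {m : Fin 3 →₀ ℕ} {i j : Fin 3}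
    (h : coeff m (wordMatrix (letterMatrix ℓ) w i j) ≠ 0) :
    w.length = m.degree ∧ (∀ t ∈ w, t ∈ Set.range ℓ) ∧ i ≤ j ∧
      ∀ k, m k ≠ 0 → i ≤ k ∧ k ≤ j := by
  classical
  induction w generalizing i m with
  | nil =>
    rw [wordMatrix_nil, Matrix.one_apply] at h
    split_ifs at h with hij
    · rw [coeff_one] at h
      split_ifs at h with hm
      · simp [hm, hij]
      · exact absurd rfl h
    · exact absurd (map_zero _) h
  | cons t w ih =>
    rw [wordMatrix_cons, map_sum] at h
    obtain ⟨k, -, hk⟩ := Finset.exists_ne_zero_of_sum_ne_zero h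
    rw [letterMatrix] at hk
    split_ifs at hk with hc
    swap
    · simp at hk
    obtain ⟨rfl, hc⟩ := hc
    rw [X_def, coeff_monomial_mul] at hk
    split_ifs at hk with hle
    swap
    · exact absurd rfl hk
    rw [one_mul] at hk
    obtain ⟨h₁, h₂, h₃, h₄⟩ := ih hk
    have hm : m - Finsupp.single k 1 + Finsupp.single k 1 = m := tsub_add_cancel_of_le hle
    have hik : i ≤ k := by
      rw [Fin.le_def]
      rcases hc with rfl | hc <;> lia
    refine ⟨?_, ?_, hik.trans h₃, ?_⟩
    · rw [← hm, map_add, Finsupp.degree_single, List.length_cons, h₁]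
    · simpa using h₂
    · intro l hl
      by_cases hlk : l = k
      · rw [hlk]
        exact ⟨hik, h₃⟩
      · have := h₄ l (by simpa [Finsupp.single_apply, Ne.symm hlk] using hl)
        exact ⟨hik.trans this.1, this.2⟩

lemma isLocallyFinite_letterMatrix : IsLocallyFinite (letterMatrix ℓ) := by
  intro m i j
  refine ((List.finite_length_eq (Fin 3) m.degree).image (List.map ℓ)).subset fun w hw => ?_
  obtain ⟨h₁, h₂, -⟩ := coeff_wordMatrix_ne_zero hw
  obtain ⟨w, rfl⟩ : w ∈ Set.range (List.map ℓ) := by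
    rw [Set.range_list_map]
    exact h₂
  exact ⟨w, by simpa using h₁, rfl⟩

lemma coeff_zero_wordMatrix_self (w : List T) (i : Fin 3) :
    coeff 0 (wordMatrix (letterMatrix ℓ) w i i) = open Classical in if w = [] then 1 else 0 := by
  split_ifs with hw
  · simp [hw, wordMatrix_nil]
  · by_contra h
    exact hw (by simpa using (coeff_wordMatrix_ne_zero h).1)

/-! ### The entries of the generating matrices -/

/-- The generating matrix of a symbol for the three letters `ℓ 0`, `ℓ 1`, `ℓ 2`. -/
noncomputable abbrev symMatrix (g : ContextFreeGrammar T) (ℓ : Fin 3 → T) (X : Symbol T g.NT) :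
    Matrix (Fin 3) (Fin 3) SeriesF2 :=
  g.genMatrix (letterMatrix ℓ) X

lemma symMatrix_supported {X : Symbol T g.NT} {m : Fin 3 →₀ ℕ} {i j : Fin 3}
    (h : coeff m (g.symMatrix ℓ X i j) ≠ 0) : i ≤ j ∧ ∀ k, m k ≠ 0 → i ≤ k ∧ k ≤ j := by
  obtain ⟨t, ht⟩ := exists_coeff_ne_zero_of_genMatrix isLocallyFinite_letterMatrix h
  exact (coeff_wordMatrix_ne_zero ht).2.2

lemma blockTriangular_symMatrix (X : Symbol T g.NT) :
    (g.symMatrix ℓ X).BlockTriangular id := by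
  intro i j hij
  ext m
  by_contra h
  exact absurd (symMatrix_supported h).1 (not_le.2 hij)

/-- The constant term of every diagonal entry counts the parse trees of the empty string modulo 2,
whatever the index. So the constant term of the determinant is one covered by
`det_one_sub_jacobian_ne_zero`. -/
lemma det_one_sub_jacobian_symMatrix_ne_zero (p q : Fin 3) :
    (1 - jacobian (fun X => g.symMatrix ℓ X p p) fun X => g.symMatrix ℓ X q q).det ≠ 0 := by
  intro h
  have h' := map_det_one_sub_jacobian (constantCoeff (σ := Fin 3) (R := ZMod 2))
    (fun X => g.symMatrix ℓ X p p) fun X => g.symMatrix ℓ X q q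
  have hpq (X : Symbol T g.NT) :
      constantCoeff (g.symMatrix ℓ X p p) = constantCoeff (g.symMatrix ℓ X q q) :=
    coeff_genMatrix_congr isLocallyFinite_letterMatrix fun w => by
      simp only [coeff_zero_wordMatrix_self]
  simp only [hpq, h, map_zero] at h'
  refine det_one_sub_jacobian_ne_zero (fun X hX => ?_) h'.symm
  obtain ⟨t, ht⟩ := exists_coeff_ne_zero_of_genMatrix isLocallyFinite_letterMatrix hX
  exact ⟨t, by simpa using (coeff_wordMatrix_ne_zero ht).1⟩

lemma blockTriangular_mul_apply_self {R : Type*} [CommRing R] {A B : Matrix (Fin 3) (Fin 3) R}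
    (hA : A.BlockTriangular id) (hB : B.BlockTriangular id) (p : Fin 3) :
    (A * B) p p = A p p * B p p := by
  rw [Matrix.mul_apply]
  refine Finset.sum_eq_single p (fun k _ hk => ?_) (by simp)
  rcases lt_or_gt_of_ne hk with h | h
  · rw [hA (i := p) (j := k) h, zero_mul]
  · rw [hB (i := k) (j := p) h, mul_zero]

/-- The product of the generating matrices of the symbols of a sentential form. -/
noncomputable abbrev formMatrix (g : ContextFreeGrammar T) (ℓ : Fin 3 → T)
    (α : List (Symbol T g.NT)) : Matrix (Fin 3) (Fin 3) SeriesF2 :=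
  (α.map (g.symMatrix ℓ)).prod

@[simp]
lemma formMatrix_nil : g.formMatrix ℓ [] = 1 := rfl

lemma formMatrix_cons (X : Symbol T g.NT) (α : List (Symbol T g.NT)) :
    g.formMatrix ℓ (X :: α) = g.symMatrix ℓ X * g.formMatrix ℓ α := by
  simp [formMatrix]

lemma blockTriangular_formMatrix (α : List (Symbol T g.NT)) :
    (g.formMatrix ℓ α).BlockTriangular id := by
  induction α with
  | nil => exact Matrix.blockTriangular_one
  | cons X α ih =>
    rw [formMatrix_cons]
    exact (blockTriangular_symMatrix X).mul ih

lemma formMatrix_apply_self (α : List (Symbol T g.NT)) (p : Fin 3) :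
    g.formMatrix ℓ α p p = (α.map fun X => g.symMatrix ℓ X p p).prod := by
  induction α with
  | nil => rw [formMatrix_nil, Matrix.one_apply_eq, List.map_nil, List.prod_nil]
  | cons X α ih =>
    rw [formMatrix_cons, blockTriangular_mul_apply_self (blockTriangular_symMatrix X)
      (blockTriangular_formMatrix α), ih, List.map_cons, List.prod_cons]

lemma symMatrix_nonterminal_apply {A : g.NT} (hA : g.IsGood (.nonterminal A)) (p q : Fin 3) :
    g.symMatrix ℓ (.nonterminal A) p q = ∑ r ∈ g.goodRules A, g.formMatrix ℓ r.output p q := by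
  rw [symMatrix, genMatrix_nonterminal isLocallyFinite_letterMatrix hA, Matrix.sum_apply]

lemma symMatrix_of_not_isGood {X : Symbol T g.NT} (hX : ¬ g.IsGood X) (p q : Fin 3) :
    g.symMatrix ℓ X p q = 0 := by
  rw [symMatrix, genMatrix_of_not_isGood hX]; rfl

lemma symMatrix_terminal_mem {σ : Set (Fin 3)} {q : Fin 3} (hq : q ∈ σ) (t : T) (p : Fin 3) :
    g.symMatrix ℓ (.terminal t) p q ∈ polySub σ := by
  rw [symMatrix, genMatrix_terminal isLocallyFinite_letterMatrix, letterMatrix]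
  split_ifs
  · exact X_mem_polySub hq
  · exact zero_mem _

lemma symMatrix_apply_self_mem (X : Symbol T g.NT) (p : Fin 3) :
    g.symMatrix ℓ X p p ∈ algVar p := by
  refine ⟨mem_algSub.2 ?_, fun m hm k hk => ?_⟩
  · refine isAlgebraic_subalgebra_of_det_ne_zero (polySub {p})
      (s := fun X => g.symMatrix ℓ X p p) (fun t => symMatrix_terminal_mem (Set.mem_singleton p) t p)
      (fun X hX => symMatrix_of_not_isGood hX p p) (fun A hA => ?_)
      (det_one_sub_jacobian_symMatrix_ne_zero p p) X
    simp only [symMatrix_nonterminal_apply hA, formMatrix_apply_self]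
  · have := (symMatrix_supported hm).2 k (Finsupp.mem_support_iff.1 hk)
    exact le_antisymm this.2 this.1

/-- The (p, q) entries solve a linear system up to an inhomogeneous term that is already a fraction.
Its determinant is nonzero and lies in `algTensor {p, q}`, so dividing by it costs only a polynomial
denominator in two variables. -/
lemma mem_fractions_of_system {P : Submonoid SeriesF2} {W : Subalgebra (ZMod 2) SeriesF2}
    {hP : P ≤ W.toSubmonoid} {p q : Fin 3} (hpq : p ≠ q) (hσP : polyNonzero {p, q} ≤ P)
    (hσW : algTensor {p, q} ≤ W)
    (h_cons : ∀ (X : Symbol T g.NT) α, g.formMatrix ℓ (X :: α) p q -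
      (g.symMatrix ℓ X p p * g.formMatrix ℓ α p q + g.formMatrix ℓ α q q * g.symMatrix ℓ X p q) ∈
        fractions P W hP) (X : Symbol T g.NT) :
    g.symMatrix ℓ X p q ∈ fractions P W hP := by
  have hterm (t : T) : g.symMatrix ℓ (.terminal t) p q ∈ fractions P W hP :=
    le_fractions (hσW (polySub_le_algTensor _ (symMatrix_terminal_mem (by simp) t p)))
  by_cases hX : g.IsGood X
  swap
  · rw [symMatrix_of_not_isGood hX]
    exact zero_mem _
  rcases X with t | A
  · exact hterm t
  have hu (X : Symbol T g.NT) : g.symMatrix ℓ X p p ∈ (algTensor {p, q}).toSubring :=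
    algVar_le_algTensor (by simp) (symMatrix_apply_self_mem X p)
  have hv (X : Symbol T g.NT) : g.symMatrix ℓ X q q ∈ (algTensor {p, q}).toSubring :=
    algVar_le_algTensor (by simp) (symMatrix_apply_self_mem X q)
  refine mem_fractions_of_mul_mem hσP hσW (det_one_sub_jacobian_mem _ hu hv)
    (det_one_sub_jacobian_symMatrix_ne_zero p q) ?_
  refine det_smul_mem (V := (fractions P W hP).toSubring.toAddSubgroup) _ hu hv
    (fun s hs m hm => mul_mem (s := fractions P W hP) (le_fractions (hσW hs)) hm)
    (h := fun α => g.formMatrix ℓ α p q) (d := fun X => g.symMatrix ℓ X p q) ?_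
    (fun X α => ?_) hterm (fun A hA => symMatrix_nonterminal_apply hA p q) hX
  · simp only [formMatrix, List.map_nil, List.prod_nil, Matrix.one_apply_ne hpq]
    exact zero_mem _
  · simp only [smul_eq_mul, ← formMatrix_apply_self]
    exact h_cons X α

lemma symMatrix_zero_one_mem (X : Symbol T g.NT) : g.symMatrix ℓ X 0 1 ∈ fractionSub {0, 1} := by
  refine mem_fractions_of_system (by simp) le_rfl le_rfl (fun X α => ?_) X
  rw [formMatrix_cons, Matrix.mul_apply, Fin.sum_univ_three,
    blockTriangular_formMatrix α (show (1 : Fin 3) < 2 by simp)]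
  convert zero_mem (fractions _ _ _) using 1
  ring

lemma symMatrix_one_two_mem (X : Symbol T g.NT) : g.symMatrix ℓ X 1 2 ∈ fractionSub {1, 2} := by
  refine mem_fractions_of_system (by simp) le_rfl le_rfl (fun X α => ?_) X
  rw [formMatrix_cons, Matrix.mul_apply, Fin.sum_univ_three,
    blockTriangular_symMatrix X (show (0 : Fin 3) < 1 by simp)]
  convert zero_mem (fractions _ _ _) using 1
  ring

lemma algVar_le_pairFractions (p : Fin 3) : algVar p ≤ pairFractions :=
  (algVar_le_algTensor (Set.mem_univ p)).trans le_fractions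

lemma formMatrix_one_two_mem (α : List (Symbol T g.NT)) :
    g.formMatrix ℓ α 1 2 ∈ pairFractions := by
  induction α with
  | nil =>
    rw [formMatrix_nil, Matrix.one_apply_ne (by simp)]
    exact zero_mem _
  | cons X α ih =>
    rw [formMatrix_cons, Matrix.mul_apply, Fin.sum_univ_three,
      blockTriangular_symMatrix X (show (0 : Fin 3) < 1 by simp), zero_mul, zero_add,
      formMatrix_apply_self]
    refine add_mem (mul_mem (algVar_le_pairFractions 1 (symMatrix_apply_self_mem X 1)) ih)
      (mul_mem ?_ (algVar_le_pairFractions 2 (list_prod_mem ?_)))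
    · exact fractions_mono (le_sup_right.trans le_sup_left) (algTensor_mono (Set.subset_univ _))
        (symMatrix_one_two_mem X)
    · simpa using fun X _ => symMatrix_apply_self_mem X 2

theorem symMatrix_zero_two_mem (X : Symbol T g.NT) : g.symMatrix ℓ X 0 2 ∈ pairFractions := by
  refine mem_fractions_of_system (by simp) le_sup_right (algTensor_mono (Set.subset_univ _))
    (fun X α => ?_) X
  rw [formMatrix_cons, Matrix.mul_apply, Fin.sum_univ_three]
  -- The path through state 1 is the only inhomogeneous term.
  have h : g.symMatrix ℓ X 0 1 * g.formMatrix ℓ α 1 2 ∈ pairFractions :=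
    mul_mem (fractions_mono (le_sup_left.trans le_sup_left)
      (algTensor_mono (Set.subset_univ _)) (symMatrix_zero_one_mem X)) (formMatrix_one_two_mem α)
  refine (congrArg (· ∈ pairFractions) ?_).mpr h
  ring

end ContextFreeGrammar

namespace ContextFreeGrammar

open MvPowerSeries SeriesF2

variable {T : Type*} {ℓ : Fin 3 → T}

/-! ### Coefficients of the matrices of words -/

lemma coeff_X_mul_eq (m : Fin 3 →₀ ℕ) (k : Fin 3) (f : SeriesF2) :
    coeff m (X k * f) = if 1 ≤ m k then coeff (m - Finsupp.single k 1) f else 0 := by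
  rw [X_def, coeff_monomial_mul, one_mul]
  simp only [Finsupp.single_le_iff]

lemma coeff_expo_X_zero_mul (n j k : ℕ) (f : SeriesF2) :
    coeff (expo (n + 1) j k) (X 0 * f) = coeff (expo n j k) f := by
  rw [coeff_X_mul_eq, if_pos (by simp),
    show expo (n + 1) j k - Finsupp.single 0 1 = expo n j k from exponent_ext_iff.2 (by simp)]

lemma coeff_expo_X_one_mul (n j k : ℕ) (f : SeriesF2) :
    coeff (expo n (j + 1) k) (X 1 * f) = coeff (expo n j k) f := by
  rw [coeff_X_mul_eq, if_pos (by simp),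
    show expo n (j + 1) k - Finsupp.single 1 1 = expo n j k from exponent_ext_iff.2 (by simp)]

lemma coeff_expo_X_two_mul (n j k : ℕ) (f : SeriesF2) :
    coeff (expo n j (k + 1)) (X 2 * f) = coeff (expo n j k) f := by
  rw [coeff_X_mul_eq, if_pos (by simp),
    show expo n j (k + 1) - Finsupp.single 2 1 = expo n j k from exponent_ext_iff.2 (by simp)]

lemma coeff_X_mul_eq_zero {m : Fin 3 →₀ ℕ} {k : Fin 3} (h : m k = 0) (f : SeriesF2) :
    coeff m (X k * f) = 0 := by
  rw [coeff_X_mul_eq, if_neg (by simp [h])]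

open Classical in
lemma wordMatrix_cons_two_two (t : T) (w : List T) :
    wordMatrix (letterMatrix ℓ) (t :: w) 2 2 =
      (if t = ℓ 2 then X 2 else 0) * wordMatrix (letterMatrix ℓ) w 2 2 := by
  rw [wordMatrix_cons, Fin.sum_univ_three]
  simp [letterMatrix]

open Classical in
lemma wordMatrix_cons_one_two (t : T) (w : List T) :
    wordMatrix (letterMatrix ℓ) (t :: w) 1 2 =
      (if t = ℓ 1 then X 1 else 0) * wordMatrix (letterMatrix ℓ) w 1 2 +
      (if t = ℓ 2 then X 2 else 0) * wordMatrix (letterMatrix ℓ) w 2 2 := by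
  rw [wordMatrix_cons, Fin.sum_univ_three]
  simp [letterMatrix]

open Classical in
lemma wordMatrix_cons_zero_two (t : T) (w : List T) :
    wordMatrix (letterMatrix ℓ) (t :: w) 0 2 =
      (if t = ℓ 0 then X 0 else 0) * wordMatrix (letterMatrix ℓ) w 0 2 +
      (if t = ℓ 1 then X 1 else 0) * wordMatrix (letterMatrix ℓ) w 1 2 := by
  rw [wordMatrix_cons, Fin.sum_univ_three]
  simp [letterMatrix]

open Classical in
lemma coeff_wordMatrix_two_two (w : List T) (n j k : ℕ) :
    coeff (expo n j k) (wordMatrix (letterMatrix ℓ) w 2 2) =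
      if n = 0 ∧ j = 0 ∧ w = List.replicate k (ℓ 2) then 1 else 0 := by
  induction w generalizing k with
  | nil =>
    rw [wordMatrix_nil, Matrix.one_apply_eq, coeff_one]
    refine if_congr ?_ rfl rfl
    rw [exponent_ext_iff, eq_comm (a := [])]
    simp
  | cons t w ih =>
    rw [wordMatrix_cons_two_two]
    rcases k with _ | k
    · by_cases ht : t = ℓ 2
      · rw [if_pos ht, coeff_X_mul_eq_zero (by simp)]
        simp
      · simp [ht]
    · by_cases ht : t = ℓ 2
      · rw [if_pos ht, coeff_expo_X_two_mul, ih]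
        simp [List.replicate_succ, ht]
      · simp [ht, List.replicate_succ]

open Classical in
lemma coeff_wordMatrix_one_two (hℓ : ℓ.Injective) (w : List T) (n j k : ℕ) :
    coeff (expo n j (k + 1)) (wordMatrix (letterMatrix ℓ) w 1 2) =
      if n = 0 ∧ w = List.replicate j (ℓ 1) ++ List.replicate (k + 1) (ℓ 2) then 1 else 0 := by
  induction w generalizing j with
  | nil => simp [wordMatrix_nil, List.replicate_succ]
  | cons t w ih =>
    have h12 : ℓ 1 ≠ ℓ 2 := hℓ.ne (by simp)
    rw [wordMatrix_cons_one_two, map_add]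
    by_cases h1 : t = ℓ 1
    · subst h1
      rw [if_pos rfl, if_neg h12, zero_mul, map_zero, add_zero]
      rcases j with _ | j
      · rw [coeff_X_mul_eq_zero (by simp)]
        simp [List.replicate_succ, h12]
      · rw [coeff_expo_X_one_mul, ih]
        simp [List.replicate_succ]
    · rw [if_neg h1, zero_mul, map_zero, zero_add]
      by_cases h2 : t = ℓ 2
      · rw [if_pos h2, coeff_expo_X_two_mul, coeff_wordMatrix_two_two]
        subst h2
        rcases j with _ | j <;> simp [List.replicate_succ, h1]
      · rw [if_neg h2, zero_mul, map_zero]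
        rcases j with _ | j <;> simp [List.replicate_succ, h1, h2]

-- State 0 is both the start and the state after `ℓ 0`, so `n` may be zero. States 1 and 2 are
-- entered only by reading their letters, hence the two shifted exponents. The words accepted have a
-- unique run, so every coefficient is 0 or 1.
open Classical in
lemma coeff_wordMatrix_zero_two (hℓ : ℓ.Injective) (w : List T) (n j k : ℕ) :
    coeff (expo n (j + 1) (k + 1)) (wordMatrix (letterMatrix ℓ) w 0 2) =
      if w = List.replicate n (ℓ 0) ++ List.replicate (j + 1) (ℓ 1) ++
        List.replicate (k + 1) (ℓ 2) then 1 else 0 := by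
  induction w generalizing n with
  | nil => simp [wordMatrix_nil, List.replicate_succ]
  | cons t w ih =>
    have h01 : ℓ 0 ≠ ℓ 1 := hℓ.ne (by simp)
    rw [wordMatrix_cons_zero_two, map_add]
    by_cases h0 : t = ℓ 0
    · subst h0
      rw [if_pos rfl, if_neg h01, zero_mul, map_zero, add_zero]
      rcases n with _ | n
      · rw [coeff_X_mul_eq_zero (by simp)]
        simp [List.replicate_succ, h01]
      · rw [coeff_expo_X_zero_mul, ih]
        simp [List.replicate_succ]
    · rw [if_neg h0, zero_mul, map_zero, zero_add]
      by_cases h1 : t = ℓ 1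
      · rw [if_pos h1, coeff_expo_X_one_mul, coeff_wordMatrix_one_two hℓ]
        subst h1
        rcases n with _ | n <;> simp [List.replicate_succ, h0]
      · rw [if_neg h1, zero_mul, map_zero]
        rcases n with _ | n <;> simp [List.replicate_succ, h0, h1]

lemma coeff_wordMatrix_zero_two_eq_zero {m : Fin 3 →₀ ℕ} (hm : m 1 = 0 ∨ m 2 = 0) (w : List T) :
    coeff m (wordMatrix (letterMatrix ℓ) w 0 2) = 0 := by
  have h2 (m : Fin 3 →₀ ℕ) (hm : m 2 = 0) (w : List T) :
      coeff m (wordMatrix (letterMatrix ℓ) w 1 2) = 0 := by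
    induction w generalizing m with
    | nil => simp [wordMatrix_nil]
    | cons t w ih =>
      rw [wordMatrix_cons_one_two, map_add, ite_mul, ite_mul, zero_mul, zero_mul]
      split_ifs <;> simp [coeff_X_mul_eq, ih, hm]
  induction w generalizing m with
  | nil => simp [wordMatrix_nil]
  | cons t w ih =>
    rw [wordMatrix_cons_zero_two, map_add, ite_mul, ite_mul, zero_mul, zero_mul]
    rcases hm with hm | hm
    · split_ifs <;> simp [coeff_X_mul_eq, ih, hm]
    · split_ifs <;> simp [coeff_X_mul_eq, ih, h2, hm]

end ContextFreeGrammar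

namespace SeriesF2

open MvPowerSeries

/-! ### The generating series of the language -/

/-- A geometric series: `P` is the disjoint union of `Q` and the shift of `P` by `d`. -/
lemma one_sub_monomial_mul_indicator {d : Fin 3 →₀ ℕ} {P Q : (Fin 3 →₀ ℕ) → Prop}
    (h : ∀ m, P m ↔ Q m ∨ (d ≤ m ∧ P (m - d))) (h' : ∀ m, Q m → ¬ (d ≤ m ∧ P (m - d))) :
    (1 - monomial d 1) * indicator P = indicator Q := by
  classical
  ext m
  rw [sub_mul, one_mul, map_sub, coeff_monomial_mul, one_mul]
  simp only [coeff_indicator, ← ite_and]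
  by_cases hQ : Q m
  · rw [if_pos hQ, if_pos ((h m).2 (Or.inl hQ)), if_neg (h' m hQ), sub_zero]
  · have : P m ↔ d ≤ m ∧ P (m - d) := by rw [h m, or_iff_right hQ]
    rw [if_neg hQ, if_congr this rfl rfl, sub_self]

lemma mem_pairFractions_of_mul_mem {σ : Set (Fin 3)} (hσ : polyNonzero σ ≤ pairDenominators)
    {q x : SeriesF2} (hq : q ∈ polyNonzero σ) (h : q * x ∈ pairFractions) :
    x ∈ pairFractions :=
  mem_fractions_of_mul_mem hσ (algTensor_mono (Set.subset_univ σ)) (polyNonzero_le σ hq)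
    (mem_polyNonzero.1 hq).2 h

lemma polyNonzero_zero_one_le : polyNonzero {0, 1} ≤ pairDenominators :=
  le_sup_left.trans le_sup_left

lemma polyNonzero_one_two_le : polyNonzero {1, 2} ≤ pairDenominators :=
  le_sup_right.trans le_sup_left

lemma monomial_mem_polySub {σ : Set (Fin 3)} {d : Fin 3 →₀ ℕ}
    (hd : (d.support : Set (Fin 3)) ⊆ σ) : (monomial d 1 : SeriesF2) ∈ polySub σ :=
  mem_polySub.2 ⟨MvPolynomial.monomial d 1, MvPolynomial.mem_supported.2 (by
    rwa [MvPolynomial.vars_monomial one_ne_zero]), MvPolynomial.coe_monomial d 1⟩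

lemma one_sub_monomial_mem {σ : Set (Fin 3)} {d : Fin 3 →₀ ℕ}
    (hd : (d.support : Set (Fin 3)) ⊆ σ) (h0 : d ≠ 0) :
    (1 - monomial d 1 : SeriesF2) ∈ polyNonzero σ := by
  classical
  refine mem_polyNonzero.2 ⟨sub_mem (one_mem _) (monomial_mem_polySub hd), fun h => ?_⟩
  have := congrArg (coeff 0) h
  rw [map_sub, coeff_zero_one, coeff_monomial, if_neg h0.symm, map_zero, sub_zero] at this
  exact one_ne_zero this

lemma support_expo_zero_right (n j : ℕ) : ((expo n j 0).support : Set (Fin 3)) ⊆ {0, 1} := by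
  intro i hi
  fin_cases i <;> simp_all

lemma support_expo_zero_left (j k : ℕ) : ((expo 0 j k).support : Set (Fin 3)) ⊆ {1, 2} := by
  intro i hi
  fin_cases i <;> simp_all

lemma indicator_eq_monomial (d : Fin 3 →₀ ℕ) : indicator (· = d) = monomial d 1 := by
  classical
  ext m
  rw [coeff_indicator, coeff_monomial]
  congr

lemma indicator_eq_monomial_mem (d : Fin 3 →₀ ℕ) : indicator (· = d) ∈ pairFractions := by
  rw [indicator_eq_monomial]
  exact le_fractions (polySub_le_algTensor _ (monomial_mem_polySub (Set.subset_univ _)))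

/-- The series is `x₀x₁x₂ / ((1 - x₂)(1 - x₀x₁))`. -/
lemma indicator_zero_eq_one_mem :
    indicator (fun m => m 0 = m 1 ∧ 1 ≤ m 1 ∧ 1 ≤ m 2) ∈ pairFractions := by
  refine mem_pairFractions_of_mul_mem polyNonzero_one_two_le
    (one_sub_monomial_mem (d := expo 0 0 1) (support_expo_zero_left 0 1)
      (by simp [exponent_ext_iff])) ?_
  rw [one_sub_monomial_mul_indicator (Q := fun m => m 0 = m 1 ∧ 1 ≤ m 1 ∧ m 2 = 1)]
  · refine mem_pairFractions_of_mul_mem polyNonzero_zero_one_le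
      (one_sub_monomial_mem (d := expo 1 1 0) (support_expo_zero_right 1 1)
        (by simp [exponent_ext_iff])) ?_
    rw [one_sub_monomial_mul_indicator (Q := fun m => m = expo 1 1 1)]
    · exact indicator_eq_monomial_mem _
    all_goals
      intro m
      simp only [exponent_ext_iff, exponent_le_iff, Finsupp.tsub_apply, expo_zero, expo_one,
        expo_two]
      lia
  all_goals
    intro m
    simp only [exponent_le_iff, Finsupp.tsub_apply, expo_zero, expo_one, expo_two]
    lia

/-- The series is `x₁x₂ / ((1 - x₀)(1 - x₁x₂))`. -/
lemma indicator_one_eq_two_mem :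
    indicator (fun m => m 1 = m 2 ∧ 1 ≤ m 1 ∧ 1 ≤ m 2) ∈ pairFractions := by
  refine mem_pairFractions_of_mul_mem polyNonzero_zero_one_le
    (one_sub_monomial_mem (d := expo 1 0 0) (support_expo_zero_right 1 0)
      (by simp [exponent_ext_iff])) ?_
  rw [one_sub_monomial_mul_indicator (Q := fun m => m 0 = 0 ∧ m 1 = m 2 ∧ 1 ≤ m 1)]
  · refine mem_pairFractions_of_mul_mem polyNonzero_one_two_le
      (one_sub_monomial_mem (d := expo 0 1 1) (support_expo_zero_left 1 1)
        (by simp [exponent_ext_iff])) ?_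
    rw [one_sub_monomial_mul_indicator (Q := fun m => m = expo 0 1 1)]
    · exact indicator_eq_monomial_mem _
    all_goals
      intro m
      simp only [exponent_ext_iff, exponent_le_iff, Finsupp.tsub_apply, expo_zero, expo_one,
        expo_two]
      lia
  all_goals
    intro m
    simp only [exponent_le_iff, Finsupp.tsub_apply, expo_zero, expo_one, expo_two]
    lia

/-- By inclusion and exclusion, the diagonal series is the sum of the two rational series minus this
one. -/
theorem indicator_someEqual_notMem :
    indicator (fun m => (m 0 = m 1 ∨ m 1 = m 2) ∧ 1 ≤ m 1 ∧ 1 ≤ m 2) ∉ pairFractions := by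
  classical
  intro h
  refine diagSeries_notMem_pairFractions ?_
  rw [show diagSeries = indicator (fun m => m 0 = m 1 ∧ 1 ≤ m 1 ∧ 1 ≤ m 2) +
      indicator (fun m => m 1 = m 2 ∧ 1 ≤ m 1 ∧ 1 ≤ m 2) -
      indicator (fun m => (m 0 = m 1 ∨ m 1 = m 2) ∧ 1 ≤ m 1 ∧ 1 ≤ m 2) from ?_]
  · exact sub_mem (add_mem indicator_zero_eq_one_mem indicator_one_eq_two_mem) h
  ext m
  simp only [diagSeries, map_add, map_sub, coeff_indicator]
  by_cases h1 : 1 ≤ m 1 ∧ 1 ≤ m 2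
  · by_cases h2 : m 0 = m 1 <;> by_cases h3 : m 1 = m 2 <;> simp_all
  · have h4 : ¬ (m 0 = m 1 ∧ m 1 = m 2 ∧ 1 ≤ m 0) := by lia
    simp [h1, h4]

end SeriesF2

/-! ### No GF(2)-grammar describes the language -/

lemma append_replicate_mem_someEqualLanguage_iff {T : Type*} {a b c : T} (hab : a ≠ b)
    (hac : a ≠ c) (hbc : b ≠ c) (n m l : ℕ) :
    List.replicate n a ++ List.replicate m b ++ List.replicate l c ∈ someEqualLanguage a b c ↔
      n = m ∨ m = l := by
  classical
  constructor
  · rintro ⟨n', m', l', h, hw⟩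
    have ha := congrArg (List.count a) hw
    have hb := congrArg (List.count b) hw
    have hc := congrArg (List.count c) hw
    simp [List.count_replicate, hab, hac, hbc, hab.symm, hac.symm, hbc.symm] at ha hb hc
    lia
  · exact fun h => ⟨n, m, l, h, rfl⟩

open MvPowerSeries SeriesF2 ContextFreeGrammar in
theorem GF2Grammar.language_ne_someEqualLanguage {T : Type*} {a b c : T} (hab : a ≠ b)
    (hac : a ≠ c) (hbc : b ≠ c) (G : GF2Grammar T) : G.language ≠ someEqualLanguage a b c := by
  classical
  intro hG
  have hmem (w : List T) : Odd (G.parseTrees G.initial w).ncard ↔ w ∈ someEqualLanguage a b c := by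
    rw [← hG]
    rfl
  have hgood : G.IsGood (.nonterminal G.initial) := by
    refine ⟨?_, G.wellFormed⟩
    -- The empty string has an odd number of parse trees, hence at least one.
    have h : ([] : List T) ∈ someEqualLanguage a b c := ⟨0, 0, 0, by simp⟩
    obtain ⟨t, -⟩ := Set.nonempty_of_ncard_ne_zero ((hmem []).2 h).pos.ne'
    exact ⟨t⟩
  let ℓ : Fin 3 → T := ![a, b, c]
  have hℓ : ℓ.Injective := by
    intro i j hij
    fin_cases i <;> fin_cases j <;> simp_all [ℓ]
  refine indicator_someEqual_notMem ?_
  rw [show indicator _ = G.symMatrix ℓ (.nonterminal G.initial) 0 2 from ?_]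
  · exact symMatrix_zero_two_mem _
  ext m
  rw [coeff_indicator]
  by_cases hm : m 1 = 0 ∨ m 2 = 0
  · rw [if_neg (by lia)]
    by_contra h
    obtain ⟨t, ht⟩ := exists_coeff_ne_zero_of_genMatrix isLocallyFinite_letterMatrix (Ne.symm h)
    exact ht (coeff_wordMatrix_zero_two_eq_zero hm _)
  obtain ⟨n, j, k, rfl⟩ : ∃ n j k, m = expo n (j + 1) (k + 1) :=
    ⟨m 0, m 1 - 1, m 2 - 1, by simp only [exponent_ext_iff, expo_zero, expo_one, expo_two]; lia⟩
  rw [coeff_genMatrix_eq_ncard isLocallyFinite_letterMatrix hgood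
    fun w => coeff_wordMatrix_zero_two hℓ w n j k]
  have key := (hmem _).trans
    (append_replicate_mem_someEqualLanguage_iff hab hac hbc n (j + 1) (k + 1))
  simp only [expo_zero, expo_one, expo_two, le_add_iff_nonneg_left, zero_le, and_true, ← key]
  split_ifs with h
  · exact (ZMod.natCast_eq_one_iff_odd.2 h).symm
  · exact (ZMod.natCast_eq_zero_iff_even.2 (Nat.not_odd_iff_even.1 h)).symm

/-! ### A context-free grammar for the language -/

namespace ContextFreeGrammar

variable {T : Type*} {g : ContextFreeGrammar T}

lemma yields_cons_terminal {t : T} {α : List (Symbol T g.NT)} {w : List T} (h : g.Yields α w) :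
    g.Yields (.terminal t :: α) (t :: w) :=
  yields_cons.2 ⟨.leaf t, w, h, by simp⟩

lemma Yields.cons {X : Symbol T g.NT} {α : List (Symbol T g.NT)} {u v : List T}
    (hu : g.Yields [X] u) (hv : g.Yields α v) : g.Yields (X :: α) (u ++ v) :=
  yields_append (α := [X]).2 ⟨u, v, hu, hv, rfl⟩

lemma Yields.of_rule {r : ContextFreeRule T g.NT} (hr : r ∈ g.rules) {w : List T}
    (h : g.Yields r.output w) : g.Yields [.nonterminal r.input] w :=
  Produces.yields ⟨r, hr, ContextFreeRule.Rewrites.input_output⟩ h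

/-- If the languages `L X` are closed under the rules of a grammar, then they contain the yields of
the parse trees. -/
lemma ParseTree.yield_mem {L : Symbol T g.NT → Language T} (hL : ∀ t, [t] ∈ L (.terminal t))
    (hr : ∀ r ∈ g.rules, (r.output.map L).prod ≤ L (.nonterminal r.input)) {X : Symbol T g.NT}
    (t : g.ParseTree X) : t.yield ∈ L X := by
  have key (α : List (Symbol T g.NT)) (f : g.Forest α)
      (h : ∀ i, (f i).yield ∈ L (α.get i)) : f.yield ∈ (α.map L).prod := by
    induction α with
    | nil => exact Language.nil_mem_one
    | cons X α ih =>
      obtain ⟨p, rfl⟩ := (Forest.consEquiv X α).surjective f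
      rw [Forest.yield_consEquiv, List.map_cons, List.prod_cons]
      exact Language.append_mem_mul (h 0) (ih p.2 fun i => h i.succ)
  induction t with
  | leaf t => simpa using hL t
  | node r h f ih => exact hr r h (key _ f ih)

/-- The nonterminals of `someEqualGrammar`. -/
inductive SomeEqualNT : Type
  | start | leftEqual | rightEqual | first | last

open SomeEqualNT Symbol in
/-- The rules of `someEqualGrammar`. -/
def someEqualRules (a b c : T) : List (ContextFreeRule T SomeEqualNT) :=
  [⟨start, [nonterminal leftEqual, nonterminal last]⟩,
    ⟨start, [nonterminal first, nonterminal rightEqual]⟩,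
    ⟨leftEqual, [terminal a, nonterminal leftEqual, terminal b]⟩, ⟨leftEqual, []⟩,
    ⟨rightEqual, [terminal b, nonterminal rightEqual, terminal c]⟩, ⟨rightEqual, []⟩,
    ⟨first, [terminal a, nonterminal first]⟩, ⟨first, []⟩,
    ⟨last, [terminal c, nonterminal last]⟩, ⟨last, []⟩]

/-- A grammar for the language `{aⁿ bᵐ cˡ | n = m or m = l}`. -/
noncomputable def someEqualGrammar (a b c : T) : ContextFreeGrammar T where
  NT := SomeEqualNT
  initial := .start
  rules := open Classical in (someEqualRules a b c).toFinset

/-- The languages of the symbols of `someEqualGrammar`. -/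
def someEqualSymbolLanguage (a b c : T) : Symbol T SomeEqualNT → Language T
  | .terminal t => {[t]}
  | .nonterminal .start => someEqualLanguage a b c
  | .nonterminal .leftEqual => {w | ∃ n, w = List.replicate n a ++ List.replicate n b}
  | .nonterminal .rightEqual => {w | ∃ n, w = List.replicate n b ++ List.replicate n c}
  | .nonterminal .first => {w | ∃ n, w = List.replicate n a}
  | .nonterminal .last => {w | ∃ n, w = List.replicate n c}

lemma prod_someEqualSymbolLanguage_le {a b c : T} {r : ContextFreeRule T SomeEqualNT}
    (hr : r ∈ someEqualRules a b c) :
    (r.output.map (someEqualSymbolLanguage a b c)).prod ≤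
      someEqualSymbolLanguage a b c (.nonterminal r.input) := by
  simp only [someEqualRules, List.mem_cons, List.not_mem_nil, or_false] at hr
  rcases hr with rfl | rfl | rfl | rfl | rfl | rfl | rfl | rfl | rfl | rfl
  all_goals
    intro w hw
    simp only [List.map_cons, List.map_nil, List.prod_cons, List.prod_nil, mul_one] at hw
  · obtain ⟨_, ⟨n, rfl⟩, _, ⟨l, rfl⟩, rfl⟩ := Language.mem_mul.1 hw
    exact ⟨n, n, l, Or.inl rfl, rfl⟩
  · obtain ⟨_, ⟨n, rfl⟩, _, ⟨l, rfl⟩, rfl⟩ := Language.mem_mul.1 hw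
    exact ⟨n, l, l, Or.inr rfl, (List.append_assoc ..).symm⟩
  · obtain ⟨_, rfl, _, hw', rfl⟩ := Language.mem_mul.1 hw
    obtain ⟨_, ⟨n, rfl⟩, _, rfl, rfl⟩ := Language.mem_mul.1 hw'
    exact ⟨n + 1, by simp [List.replicate_succ, ← List.replicate_succ']⟩
  · obtain rfl := hw
    exact ⟨0, rfl⟩
  · obtain ⟨_, rfl, _, hw', rfl⟩ := Language.mem_mul.1 hw
    obtain ⟨_, ⟨n, rfl⟩, _, rfl, rfl⟩ := Language.mem_mul.1 hw'
    exact ⟨n + 1, by simp [List.replicate_succ, ← List.replicate_succ']⟩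
  · obtain rfl := hw
    exact ⟨0, rfl⟩
  · obtain ⟨_, rfl, _, ⟨n, rfl⟩, rfl⟩ := Language.mem_mul.1 hw
    exact ⟨n + 1, rfl⟩
  · obtain rfl := hw
    exact ⟨0, rfl⟩
  · obtain ⟨_, rfl, _, ⟨n, rfl⟩, rfl⟩ := Language.mem_mul.1 hw
    exact ⟨n + 1, rfl⟩
  · obtain rfl := hw
    exact ⟨0, rfl⟩

lemma yields_replicate {A : g.NT} {t : T} (h₀ : ⟨A, []⟩ ∈ g.rules)
    (h₁ : ⟨A, [.terminal t, .nonterminal A]⟩ ∈ g.rules) (n : ℕ) :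
    g.Yields [.nonterminal A] (List.replicate n t) := by
  induction n with
  | zero => exact .of_rule h₀ (yields_nil.2 rfl)
  | succ n ih => exact .of_rule h₁ (yields_cons_terminal ih)

lemma yields_replicate_append_replicate {A : g.NT} {s t : T} (h₀ : ⟨A, []⟩ ∈ g.rules)
    (h₁ : ⟨A, [.terminal s, .nonterminal A, .terminal t]⟩ ∈ g.rules) (n : ℕ) :
    g.Yields [.nonterminal A] (List.replicate n s ++ List.replicate n t) := by
  induction n with
  | zero => exact .of_rule h₀ (yields_nil.2 rfl)
  | succ n ih =>
    rw [List.replicate_succ, List.replicate_succ', List.cons_append, ← List.append_assoc]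
    exact .of_rule h₁ (yields_cons_terminal (ih.cons (yields_map_terminal [t])))

lemma language_someEqualGrammar (a b c : T) :
    (someEqualGrammar a b c).language = someEqualLanguage a b c := by
  classical
  have hmem {r} (hr : r ∈ someEqualRules a b c) : r ∈ (someEqualGrammar a b c).rules :=
    List.mem_toFinset.2 hr
  ext w
  rw [mem_language_iff_exists_parseTree]
  constructor
  · rintro ⟨t, rfl⟩
    exact t.yield_mem (L := someEqualSymbolLanguage a b c) (fun _ => rfl)
      fun r hr => prod_someEqualSymbolLanguage_le (List.mem_toFinset.1 hr)
  · rw [← yields_singleton]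
    rintro ⟨n, m, l, rfl | rfl, rfl⟩
    · refine Yields.of_rule (hmem (List.mem_cons_self ..)) (Yields.cons ?_ ?_)
      · exact yields_replicate_append_replicate (hmem (by repeat constructor))
          (hmem (by repeat constructor)) n
      · exact yields_replicate (hmem (by repeat constructor)) (hmem (by repeat constructor)) l
    · rw [List.append_assoc]
      refine Yields.of_rule (hmem (List.mem_cons_of_mem _ (List.mem_cons_self ..)))
        (Yields.cons ?_ ?_)
      · exact yields_replicate (hmem (by repeat constructor)) (hmem (by repeat constructor)) n
      · exact yields_replicate_append_replicate (hmem (by repeat constructor))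
          (hmem (by repeat constructor)) m

end ContextFreeGrammar

theorem mainTheorem6 {T : Type*} (a b c : T) (hab : a ≠ b) (hac : a ≠ c) (hbc : b ≠ c) :
    (¬ ∃ G : GF2Grammar T, G.language = someEqualLanguage a b c) ∧
      (someEqualLanguage a b c).IsInherentlyAmbiguous := by
  have h : ¬ ∃ G : GF2Grammar T, G.language = someEqualLanguage a b c :=
    fun ⟨G, hG⟩ => G.language_ne_someEqualLanguage hab hac hbc hG
  refine ⟨h, ⟨_, ContextFreeGrammar.language_someEqualGrammar a b c⟩, fun g hg hu => h ?_⟩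
  obtain ⟨G, hG⟩ := hu.exists_gf2Grammar
  exact ⟨G, hG.trans hg⟩
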